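/- **Setting.** Let $q\ge 1$, $n\ge 0$. Throughout $\|\cdot\|$ is the $\ell_1$ norm on $\mathbb R^q$ and $B_1(0)$ its closed unit ball, $\operatorname{cone}A$ is the convex conic hull ($\operatorname{cone}\emptyset=\{0\}$), $A^+=\{z\mid z^{\mathsf T}a\ge 0\ \forall a\in A\}$, $A_\infty=\{d\mid y+\alpha d\in A\ \forall y\in A,\alpha\ge0\}$, $\operatorname{vert}$ denotes the set of extreme points, and $d_H$ is the Hausdorff distance for $\|\cdot\|$. A nonzero $w\in A$ is an extreme direction of a cone $A$ if it is not a convex combination of elements of $A\setminus\operatorname{cone}\{w\}$. Consider $$\text{(P)}\qquad \text{minimize } \Gamma(x)\ \text{ with respect to }\le_C\ \text{ subject to } x\in\mathcal X,$$ where $\mathcal X\subseteq\mathbb R^n$ is closed and convex with nonempty interior, $C\subseteq\mathbb R^q$ is a closed, pointed, solid, polyhedral convex cone with $\{0\}\neq C\ne\mathbb R^q$, and $\Gamma:\mathcal X\to\mathbb R^q$ is continuous and $C$-convex. Its upper image is $\mathcal P=\operatorname{cl}(\Gamma(\mathcal X)+C)$. Fix $c\in\operatorname{int}C$ with $\|c\|=1$,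 a nonsingular $T\in\mathbb R^{q\times q}$ with last column $c$, finite sets $R$, $R^*$ generating $C$ and $C^+$ with $\|d\|=1$ for $d\in R$ and $c^{\mathsf T}z=1$ for $z\in R^*$, and tolerances $\varepsilon,\delta>0$. **Scalarizations.** (P$_1(w)$): minimize $w^{\mathsf T}\Gamma(x)$ over $x\in\mathcal X$. (P$_2(v,d)$), $d\ne0$: maximize $z$ subject to $x\in\mathcal X$, $z\in\mathbb R$, $v+zd-\Gamma(x)\in C$. (D$_2(v,d)$): minimize $\sup_{x\in\mathcal X}\{-w^{\mathsf T}\Gamma(x)\}+w^{\mathsf T}v$ subject to $w\in C^+$, $w^{\mathsf T}d=-1$. **Geometric dual.** Let $w(t)=((t_1,\dots,t_{q-1},1)T^{-1})^{\mathsf T}$, $D^*(t)=(t_1,\dots,t_{q-1},\inf_{x\in\mathcal X}w(t)^{\mathsf T}\Gamma(x))\in\mathbb R^{q-1}\times[-\infty,\infty]$, $K=\mathbb R_+e^q$. The geometric dual (D) is: maximize $D^*(t)$ with respect to $\le_K$ subject to $w(t)\in C^+$. For a set $\mathcal Y$, (D$'$) is the same problem with the constraint $w(t)\in(\operatorname{cone}\mathcal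 Y)^+$; $\mathcal T'$ is its feasible set and $\mathcal D'=D^*(\mathcal T')-K$ its lower image. **Solution concepts.** A set $\mathcal Y$ is a $\delta$-outer approximation of $\mathcal P_\infty$ if $\mathcal P_\infty\subseteq\operatorname{cone}\mathcal Y$ and $d_H(\mathcal P_\infty\cap B_1(0),\operatorname{cone}\mathcal Y\cap B_1(0))\le\delta$. A pair $(\bar{\mathcal X},\mathcal Y)$ of finite sets is a finite weak $(\varepsilon,\delta)$-solution of (P) if $\bar{\mathcal X}\ne\emptyset$, every $\bar x\in\bar{\mathcal X}$ is a weak minimizer ($\bar x\in\mathcal X$ and $(\Gamma(\bar x)-\operatorname{int}C)\cap\Gamma(\mathcal X)=\emptyset$), $\mathcal Y$ is a $\delta$-outer approximation of $\mathcal P_\infty$, and $\mathcal P\subseteq\operatorname{conv}\Gamma(\bar{\mathcal X})+\operatorname{cone}\mathcal Y-\varepsilon\{c\}$. A pair $(\bar{\mathcal T},\mathcal Y)$ of finite sets is a finite $(\varepsilon,\delta)$-solution of (D) if $\mathcal Y$ is a $\delta$-outer approximation of $\mathcal P_\infty$, $\bar{\mathcal T}\subseteq\mathcal T'$, $D^*(t)$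 is a $K$-maximal element of $D^*(\mathcal T')$ for each $t\in\bar{\mathcal T}$, and $\mathcal D'\subseteq\operatorname{conv}D^*(\bar{\mathcal T})-K+\varepsilon\{e^q\}$. **Initialization algorithm.** Below, "cut with $(x,w)$" means: add $x$ to $\bar{\mathcal X}$, add $T^{\mathsf T}w/(c^{\mathsf T}w)$ to $\bar{\mathcal T}$, and replace $\mathcal P_0$ by $\mathcal P_0\cap\{y\mid w^{\mathsf T}(y-\Gamma(x))\ge0\}$. Start with $\mathcal Y_{In}=R$, $\hat C=\bar{\mathcal X}=\bar{\mathcal T}=\emptyset$, $\mathcal P_0=\mathbb R^q$; choose $x_0\in\mathcal X$ and put $v=\Gamma(x_0)+\sum_{d\in R}d$. For each $z\in R^*$, solve (P$_1(z)$): if it has an optimal solution $x^*$, cut with $(x^*,z)$. If none of these problems is unbounded, set $\mathcal Y_{Out}=R$ and stop. Otherwise, for each $d\in-R$: if (P$_2(v,d)$) is unbounded, add $d$ to $\mathcal Y_{In}$; if $(x,z)$ and $w$ are optimal for (P$_2(v,d)$) and (D$_2(v,d)$), cut with $(x,w)$. Then set $\mathcal Y_{Out}=\operatorname{vert}((\mathcal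 P_0)_\infty\cap B_1(0))\setminus\{0\}$. While $\mathcal Y_{Out}\setminus(\mathcal Y_{In}\cup\hat C)\ne\emptyset$, take an element $d$ of it and $\tilde r\in\mathcal Y_{In}$ nearest to $d$. If $\|d-\tilde r\|\le\delta$, add $d$ to $\hat C$. Otherwise choose $\lambda\in(0,1)$ with $e:=\lambda d+(1-\lambda)\tilde r\neq0$; if (P$_2(v,e)$) is unbounded, add $e/\|e\|$ to $\mathcal Y_{In}$; if $(x,z)$ and $w$ are optimal for (P$_2(v,e)$) and (D$_2(v,e)$), cut with $(x,w)$ and recompute $\mathcal Y_{Out}$ by the same formula. **Dual algorithm.** (1) Run the initialization algorithm and set $\mathcal D_0=\{t\mid w(t)\in(\operatorname{cone}\mathcal Y_{Out})^+\}\cap\bigcap_{x\in\bar{\mathcal X}}\{t\mid w(t)^{\mathsf T}\Gamma(x)-t_q\ge0\}$. (2) If (P$_1(w)$) is unbounded for some extreme direction $w$ of $(\operatorname{cone}\mathcal Y_{Out})^+$, stop. (3) Set $k=0$, $M=\emptyset$. (4) While $M\ne\mathbb R^q$: set $M=\mathbb R^q$; for each vertex $u$ of $\mathcal D_k$ compute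 an optimal solution $x^u$ of (P$_1(w(u))$), add $x^u$ to $\bar{\mathcal X}$ and $T^{\mathsf T}w(u)$ to $\bar{\mathcal T}$, and, if $u_q-w(u)^{\mathsf T}\Gamma(x^u)>\varepsilon$, replace $M$ by $M\cap\{t\mid w(t)^{\mathsf T}\Gamma(x^u)\ge t_q\}$; if then $M\ne\mathbb R^q$, set $\mathcal D_{k+1}=\mathcal D_k\cap M$ and increase $k$ by one. Output $\bar{\mathcal X},\mathcal Y_{Out},\bar{\mathcal T}$. The algorithm terminates (outside Step 2) if the test in Step 2 is passed, every scalar problem to be solved is either found unbounded, where that case is provided for, or has the optimal solutions asked for, and all loops end after finitely many rounds. **Theorem.** Suppose that the dual algorithm terminates outside its Step 2, with any admissible choices made along the way. Then $(\bar{\mathcal T},\mathcal Y_{Out})$ is a finite $(\varepsilon,\delta)$-solution of (D), and, provided that $\mathcal P\neq\mathbb R^q$, $(\bar{\mathcal X},\mathcal Y_{Out})$ is a finite weak $(\varepsilon,\delta)$-solution of (P). -/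

import Mathlib

open Set
open scoped Matrix Pointwise

namespace UnboundedCVOP

noncomputable section

/-! ### Convex-analytic notions in `ℝ^q` -/

/-- The `ℓ₁` norm on `ℝ^q`. -/
def l1norm {q : ℕ} (y : Fin q → ℝ) : ℝ := ∑ i, |y i|

/-- The closed `ℓ₁` unit ball around the origin. -/
def l1Ball (q : ℕ) : Set (Fin q → ℝ) := {y | l1norm y ≤ 1}

/-- The Hausdorff distance with respect to the `ℓ₁` norm. -/
def l1Hausdorff {q : ℕ} (A B : Set (Fin q → ℝ)) : ENNReal :=
  Metric.hausdorffEDist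
    ((fun y => (WithLp.toLp 1 y : PiLp 1 fun _ : Fin q => ℝ)) '' A)
    ((fun y => (WithLp.toLp 1 y : PiLp 1 fun _ : Fin q => ℝ)) '' B)

/-- The convex conic hull, with `cone ∅ = {0}`. -/
def cone {q : ℕ} (Y : Set (Fin q → ℝ)) : Set (Fin q → ℝ) := (PointedCone.hull ℝ Y : Set _)

/-- The positive dual cone. -/
def dualCone {q : ℕ} (A : Set (Fin q → ℝ)) : Set (Fin q → ℝ) := {z | ∀ a ∈ A, 0 ≤ z ⬝ᵥ a}

/-- The recession cone. -/
def recessionCone {q : ℕ} (A : Set (Fin q → ℝ)) : Set (Fin q → ℝ) :=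
  {d | ∀ y ∈ A, ∀ α : ℝ, 0 ≤ α → y + α • d ∈ A}

/-- Polyhedral convex sets: finite intersections of closed halfspaces. -/
def IsPolyhedral {q : ℕ} (A : Set (Fin q → ℝ)) : Prop :=
  ∃ (r : ℕ) (w : Fin r → Fin q → ℝ) (γ : Fin r → ℝ),
    (∀ i, w i ≠ 0) ∧ A = {y | ∀ i, γ i ≤ w i ⬝ᵥ y}

/-- `w` is an extreme direction of the cone `A`: a nonzero element that is not a convex combination
of elements of `A \ cone {w}`. -/
def IsExtremeDirection {q : ℕ} (A : Set (Fin q → ℝ)) (w : Fin q → ℝ) : Prop :=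
  w ∈ A ∧ w ≠ 0 ∧ w ∉ convexHull ℝ (A \ cone {w})

/-- The nonzero vertices of `A_∞ ∩ B₁(0)`. -/
def outerDirections {q : ℕ} (A : Set (Fin q → ℝ)) : Set (Fin q → ℝ) :=
  (recessionCone A ∩ l1Ball q).extremePoints ℝ \ {0}

/-! ### Convex vector optimization problems -/

/-- The data of the problem: minimize `Γ x` with respect to `≤_C` subject to `x ∈ X`.
The image space is `ℝ^q` with `q = m + 1`; only the values of `Γ` on `X` matter. -/
structure CVOP (n m : ℕ) where
  X : Set (Fin n → ℝ)
  Γ : (Fin n → ℝ) → (Fin (m + 1) → ℝ)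
  C : PointedCone ℝ (Fin (m + 1) → ℝ)

namespace CVOP

variable {n m : ℕ}

/-- The standing assumptions on the problem, including polyhedrality of the ordering cone. -/
structure Assumption (P : CVOP n m) : Prop where
  X_closed : IsClosed P.X
  X_convex : Convex ℝ P.X
  X_interior : (interior P.X).Nonempty
  C_closed : IsClosed (P.C : Set (Fin (m + 1) → ℝ))
  C_ne_zero : (P.C : Set (Fin (m + 1) → ℝ)) ≠ {0}
  C_ne_univ : (P.C : Set (Fin (m + 1) → ℝ)) ≠ univ
  C_pointed : ∀ y ∈ P.C, -y ∈ P.C → y = 0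
  C_solid : (interior (P.C : Set (Fin (m + 1) → ℝ))).Nonempty
  C_polyhedral : IsPolyhedral (P.C : Set (Fin (m + 1) → ℝ))
  Γ_continuous : ContinuousOn P.Γ P.X
  Γ_convex : ∀ x ∈ P.X, ∀ y ∈ P.X, ∀ α : ℝ, 0 ≤ α → α ≤ 1 →
    α • P.Γ x + (1 - α) • P.Γ y - P.Γ (α • x + (1 - α) • y) ∈ P.C

/-- The upper image `cl (Γ(X) + C)`. -/
def upperImage (P : CVOP n m) : Set (Fin (m + 1) → ℝ) :=
  closure (P.Γ '' P.X + (P.C : Set (Fin (m + 1) → ℝ)))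

/-- `x` is a weak minimizer: `x ∈ X` and `({Γ x} - int C) ∩ Γ(X) = ∅`. -/
def IsWeakMinimizer (P : CVOP n m) (x : Fin n → ℝ) : Prop :=
  x ∈ P.X ∧
    ({P.Γ x} - interior (P.C : Set (Fin (m + 1) → ℝ))) ∩ P.Γ '' P.X = ∅

/-- `Y` is a `δ`-outer approximation of the recession cone of the upper image. -/
def IsOuterApprox (P : CVOP n m) (δ : ℝ) (Y : Set (Fin (m + 1) → ℝ)) : Prop :=
  recessionCone P.upperImage ⊆ cone Y ∧
    l1Hausdorff (recessionCone P.upperImage ∩ l1Ball (m + 1)) (cone Y ∩ l1Ball (m + 1)) ≤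
      ENNReal.ofReal δ

/-- `(Xbar, Y)` is a finite weak `(ε, δ)`-solution of the problem (with fixed direction `c`). -/
structure IsFiniteWeakSolution (P : CVOP n m) (c : Fin (m + 1) → ℝ) (ε δ : ℝ)
    (Xbar : Set (Fin n → ℝ)) (Y : Set (Fin (m + 1) → ℝ)) : Prop where
  finite_X : Xbar.Finite
  finite_Y : Y.Finite
  nonempty : Xbar.Nonempty
  weak_minimizers : ∀ x ∈ Xbar, P.IsWeakMinimizer x
  outer : P.IsOuterApprox δ Y
  approx : P.upperImage ⊆ convexHull ℝ (P.Γ '' Xbar) + cone Y - {ε • c}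

/-! ### Scalarizations -/

/-- The weighted sum problem `min wᵀ Γ(x)`, `x ∈ X`, is bounded. -/
def P1Bounded (P : CVOP n m) (w : Fin (m + 1) → ℝ) : Prop :=
  BddBelow ((fun x => w ⬝ᵥ P.Γ x) '' P.X)

/-- `x` is an optimal solution of the weighted sum problem. -/
def P1Optimal (P : CVOP n m) (w : Fin (m + 1) → ℝ) (x : Fin n → ℝ) : Prop :=
  x ∈ P.X ∧ ∀ x' ∈ P.X, w ⬝ᵥ P.Γ x ≤ w ⬝ᵥ P.Γ x'

/-- `(x, z)` is feasible for the Pascoletti-Serafini problem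
`max z` s.t. `x ∈ X`, `Γ(x) - v - z d ≤_C 0`. -/
def P2Feasible (P : CVOP n m) (v d : Fin (m + 1) → ℝ) (x : Fin n → ℝ) (z : ℝ) : Prop :=
  x ∈ P.X ∧ v + z • d - P.Γ x ∈ P.C

/-- The Pascoletti-Serafini problem is unbounded. -/
def P2Unbounded (P : CVOP n m) (v d : Fin (m + 1) → ℝ) : Prop :=
  ¬ BddAbove {z : ℝ | ∃ x, P.P2Feasible v d x z}

/-- `(x, z)` is an optimal solution of the Pascoletti-Serafini problem. -/
def P2Optimal (P : CVOP n m) (v d : Fin (m + 1) → ℝ) (x : Fin n → ℝ) (z : ℝ) : Prop :=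
  P.P2Feasible v d x z ∧ ∀ x' z', P.P2Feasible v d x' z' → z' ≤ z

/-- Feasibility for the Lagrangian dual of the Pascoletti-Serafini problem. -/
def D2Feasible (P : CVOP n m) (d w : Fin (m + 1) → ℝ) : Prop :=
  w ⬝ᵥ d = -1 ∧ w ∈ dualCone (P.C : Set (Fin (m + 1) → ℝ))

/-- The objective `sup_{x ∈ X} (-wᵀ Γ(x)) + wᵀ v` of the Lagrangian dual. -/
def D2Objective (P : CVOP n m) (v w : Fin (m + 1) → ℝ) : EReal :=
  (⨆ x ∈ P.X, ((-(w ⬝ᵥ P.Γ x) : ℝ) : EReal)) + ((w ⬝ᵥ v : ℝ) : EReal)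

/-- `w` is an optimal solution of the Lagrangian dual. -/
def D2Optimal (P : CVOP n m) (v d w : Fin (m + 1) → ℝ) : Prop :=
  P.D2Feasible d w ∧ ∀ w', P.D2Feasible d w' → P.D2Objective v w ≤ P.D2Objective v w'

end CVOP

/-! ### The geometric dual problem -/

section GeometricDual

variable {n m : ℕ}

/-- `w(t) = ((t₁, …, t_{q-1}, 1) T⁻¹)ᵀ`. -/
def wOf (T : Matrix (Fin (m + 1)) (Fin (m + 1)) ℝ) (t : Fin (m + 1) → ℝ) : Fin (m + 1) → ℝ :=
  Function.update t (Fin.last m) 1 ᵥ* T⁻¹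

/-- The space `ℝ^{q-1} × [-∞, ∞]` in which the dual objective takes its values. -/
abbrev ExtSpace (m : ℕ) : Type := (Fin m → ℝ) × EReal

/-- The inclusion `ℝ^q ⊆ ℝ^{q-1} × [-∞, ∞]`. -/
def toExt (y : Fin (m + 1) → ℝ) : ExtSpace m := (Fin.init y, ((y (Fin.last m) : ℝ) : EReal))

/-- `y + k e^q` in `ℝ^{q-1} × [-∞, ∞]`. -/
def shift (y : ExtSpace m) (k : ℝ) : ExtSpace m := (y.1, y.2 + (k : EReal))

/-- The dual ordering cone `K = ℝ₊ e^q`. -/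
def coneK (m : ℕ) : Set (Fin (m + 1) → ℝ) := {y | ∃ k : ℝ, 0 ≤ k ∧ y = Pi.single (Fin.last m) k}

/-- The dual objective `D*(t) = (t₁, …, t_{q-1}, inf_{x ∈ X} w(t)ᵀ Γ(x))`. -/
def dualObjective (P : CVOP n m) (T : Matrix (Fin (m + 1)) (Fin (m + 1)) ℝ)
    (t : Fin (m + 1) → ℝ) : ExtSpace m :=
  (Fin.init t, ⨅ x ∈ P.X, ((wOf T t ⬝ᵥ P.Γ x : ℝ) : EReal))

/-- The feasible region `{t | w(t) ∈ A⁺}` of the geometric dual problem with ordering cone `A` in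
the primal image space. -/
def dualFeasible (T : Matrix (Fin (m + 1)) (Fin (m + 1)) ℝ) (A : Set (Fin (m + 1) → ℝ)) :
    Set (Fin (m + 1) → ℝ) :=
  {t | wOf T t ∈ dualCone A}

/-- The lower image `D*(𝒯) - K`. -/
def lowerImage (P : CVOP n m) (T : Matrix (Fin (m + 1)) (Fin (m + 1)) ℝ)
    (A : Set (Fin (m + 1) → ℝ)) : Set (ExtSpace m) :=
  {y | ∃ t ∈ dualFeasible T A, ∃ k : ℝ, 0 ≤ k ∧ y = shift (dualObjective P T t) (-k)}

/-- `t` is feasible and `D*(t)` is a `K`-maximal element of `D*(𝒯)`, that is,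
`({D*(t)} + K \ {0}) ∩ D*(𝒯) = ∅`. (This forces the last entry of `D*(t)` to be finite.) -/
def IsDualMaximizer (P : CVOP n m) (T : Matrix (Fin (m + 1)) (Fin (m + 1)) ℝ)
    (A : Set (Fin (m + 1) → ℝ)) (t : Fin (m + 1) → ℝ) : Prop :=
  t ∈ dualFeasible T A ∧
    ∀ k : ℝ, 0 < k → shift (dualObjective P T t) k ∉ dualObjective P T '' dualFeasible T A

/-- `Tbar` is a finite `ε`-solution of: maximize `D*(t)` w.r.t. `≤_K` subject to `w(t) ∈ A⁺`.
All points of `D*(Tbar)` lie in `ℝ^q`, so their convex hull is formed there. -/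
structure IsFiniteDualEpsSolution (P : CVOP n m) (T : Matrix (Fin (m + 1)) (Fin (m + 1)) ℝ)
    (A : Set (Fin (m + 1) → ℝ)) (ε : ℝ) (Tbar : Set (Fin (m + 1) → ℝ)) : Prop where
  finite : Tbar.Finite
  maximizers : ∀ t ∈ Tbar, IsDualMaximizer P T A t
  approx : lowerImage P T A ⊆
    toExt '' (convexHull ℝ (toExt ⁻¹' (dualObjective P T '' Tbar)) - coneK m
      + {Pi.single (Fin.last m) ε})

/-- `(Tbar, Y)` is a finite `(ε, δ)`-solution of the geometric dual problem: `Y` is a finite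
`δ`-outer approximation and `Tbar` is a finite `ε`-solution of the dual problem modified by
replacing the constraint `w(t) ∈ C⁺` by `w(t) ∈ (cone Y)⁺`. -/
structure IsFiniteDualSolution (P : CVOP n m) (T : Matrix (Fin (m + 1)) (Fin (m + 1)) ℝ)
    (ε δ : ℝ) (Tbar Y : Set (Fin (m + 1) → ℝ)) : Prop where
  finite_Y : Y.Finite
  outer : P.IsOuterApprox δ Y
  eps_solution : IsFiniteDualEpsSolution P T (cone Y) ε Tbar

end GeometricDual

/-! ### Control flow: terminating runs of (nondeterministic) programs as relations on states -/

/-- Running `body a` successively for the entries `a` of a list. -/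
inductive RunList {α σ : Type} (body : α → σ → σ → Prop) : List α → σ → σ → Prop
  | nil (s : σ) : RunList body [] s s
  | cons {a : α} {l : List α} {s s' s'' : σ} :
      body a s s' → RunList body l s' s'' → RunList body (a :: l) s s''

/-- "For all `a ∈ A` do `body a`", in some order, each element once. -/
def ForEach {α σ : Type} (A : Set α) (body : α → σ → σ → Prop) (s s' : σ) : Prop :=
  ∃ l : List α, l.Nodup ∧ (∀ a, a ∈ l ↔ a ∈ A) ∧ RunList body l s s'

/-- "While `cond` do `body`", terminating after finitely many rounds. -/
def While {σ : Type} (cond : σ → Prop) (body : σ → σ → Prop) (s s' : σ) : Prop :=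
  Relation.ReflTransGen (fun a b => cond a ∧ body a b) s s' ∧ ¬ cond s'

/-! ### Parameters of the algorithms -/

/-- The fixed data: the direction `c`, the matrix `T`, generating directions `R` of `C` and
`Rstar` of `C⁺`. -/
structure Params (m : ℕ) where
  c : Fin (m + 1) → ℝ
  T : Matrix (Fin (m + 1)) (Fin (m + 1)) ℝ
  R : Finset (Fin (m + 1) → ℝ)
  Rstar : Finset (Fin (m + 1) → ℝ)

/-- The requirements on the fixed data. -/
structure Params.Admissible {n m : ℕ} (p : Params m) (P : CVOP n m) : Prop where
  c_mem : p.c ∈ interior (P.C : Set (Fin (m + 1) → ℝ))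
  c_norm : l1norm p.c = 1
  T_nonsingular : IsUnit p.T.det
  T_last_column : ∀ i, p.T i (Fin.last m) = p.c i
  R_generates : cone (p.R : Set (Fin (m + 1) → ℝ)) = (P.C : Set (Fin (m + 1) → ℝ))
  R_norm : ∀ d ∈ p.R, l1norm d = 1
  Rstar_generates : cone (p.Rstar : Set (Fin (m + 1) → ℝ)) =
    dualCone (P.C : Set (Fin (m + 1) → ℝ))
  Rstar_norm : ∀ z ∈ p.Rstar, p.c ⬝ᵥ z = 1

/-! ### The initialization algorithm: outer approximation of the recession cone -/

/-- The variables of the initialization algorithm. -/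
structure InitState (n m : ℕ) where
  YIn : Set (Fin (m + 1) → ℝ)
  YOut : Set (Fin (m + 1) → ℝ)
  Chat : Set (Fin (m + 1) → ℝ)
  P0 : Set (Fin (m + 1) → ℝ)
  Xbar : Set (Fin n → ℝ)
  Tbar : Set (Fin (m + 1) → ℝ)
  b : Bool

section InitAlgorithm

variable {n m : ℕ}

/-- Initial values of the variables (`YOut` is assigned before it is first read). -/
def initStart (p : Params m) : InitState n m where
  YIn := p.R
  YOut := ∅
  Chat := ∅
  P0 := univ
  Xbar := ∅
  Tbar := ∅
  b := true

/-- Update by an optimal point `x` and a weight `w`: store `x`, store the normalized dual point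
`Tᵀ (w / cᵀw)`, and cut `P0` with `{y | wᵀ (y - Γ(x)) ≥ 0}`. -/
def InitState.cut (P : CVOP n m) (p : Params m) (x : Fin n → ℝ) (w : Fin (m + 1) → ℝ)
    (s : InitState n m) : InitState n m :=
  { s with
    Xbar := insert x s.Xbar
    Tbar := insert (p.Tᵀ *ᵥ ((p.c ⬝ᵥ w)⁻¹ • w)) s.Tbar
    P0 := s.P0 ∩ {y | 0 ≤ w ⬝ᵥ (y - P.Γ x)} }

/-- Boundedness check for `z ∈ Rstar`. Here `cᵀz = 1`, so the dual point stored is `Tᵀ z`. -/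
def checkBounded (P : CVOP n m) (p : Params m) (z : Fin (m + 1) → ℝ)
    (s s' : InitState n m) : Prop :=
  (¬ P.P1Bounded z ∧ s' = { s with b := false }) ∨
  (∃ x, P.P1Optimal z x ∧ s' = s.cut P p x z)

/-- Check for lineality directions, for `d ∈ -R`. -/
def checkLineality (P : CVOP n m) (p : Params m) (v d : Fin (m + 1) → ℝ)
    (s s' : InitState n m) : Prop :=
  (P.P2Unbounded v d ∧ s' = { s with YIn := insert d s.YIn }) ∨
  (∃ x z w, P.P2Optimal v d x z ∧ P.D2Optimal v d w ∧ s' = s.cut P p x w)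

/-- `YOut ← vert ((P0)_∞ ∩ B₁(0)) \ {0}`. -/
def InitState.recomputeYOut (s : InitState n m) : InitState n m :=
  { s with YOut := outerDirections s.P0 }

/-- Loop condition of the iteration phase. -/
def initCond (s : InitState n m) : Prop := (s.YOut \ (s.YIn ∪ s.Chat)).Nonempty

/-- One round of the iteration phase. The number `λ ∈ (0,1)` may be chosen anew in each round; the
direction of the Pascoletti-Serafini problem has to be nonzero. -/
def initBody (P : CVOP n m) (p : Params m) (δ : ℝ) (v : Fin (m + 1) → ℝ)
    (s s' : InitState n m) : Prop :=
  ∃ d ∈ s.YOut \ (s.YIn ∪ s.Chat), ∃ r ∈ s.YIn, (∀ r' ∈ s.YIn, l1norm (d - r) ≤ l1norm (d - r')) ∧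
    ((l1norm (d - r) ≤ δ ∧ s' = { s with Chat := insert d s.Chat }) ∨
     (δ < l1norm (d - r) ∧ ∃ lam : ℝ, 0 < lam ∧ lam < 1 ∧
       ∃ e, e = lam • d + (1 - lam) • r ∧ e ≠ 0 ∧
        ((P.P2Unbounded v e ∧ s' = { s with YIn := insert ((l1norm e)⁻¹ • e) s.YIn }) ∨
         (∃ x z w, P.P2Optimal v e x z ∧ P.D2Optimal v e w ∧
            s' = (s.cut P p x w).recomputeYOut))))

/-- A terminating run of the initialization algorithm on a feasible problem, with output `out`. -/
def InitRun (P : CVOP n m) (p : Params m) (δ : ℝ) (out : InitState n m) : Prop :=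
  ∃ x₀ ∈ P.X, ∃ s₁ : InitState n m,
    ForEach (p.Rstar : Set (Fin (m + 1) → ℝ)) (checkBounded P p) (initStart p) s₁ ∧
    ((s₁.b = true ∧ out = { s₁ with YOut := p.R }) ∨
     (s₁.b = false ∧ ∃ s₂ : InitState n m,
        ForEach (-(p.R : Set (Fin (m + 1) → ℝ))) (checkLineality P p (P.Γ x₀ + ∑ d ∈ p.R, d))
          s₁ s₂ ∧
        While initCond (initBody P p δ (P.Γ x₀ + ∑ d ∈ p.R, d)) s₂.recomputeYOut out))

end InitAlgorithm

/-! ### The dual algorithm -/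

/-- The variables of the main loop of the dual algorithm; `D` is the current outer approximation
`D_k`. -/
structure DualState (n m : ℕ) where
  D : Set (Fin (m + 1) → ℝ)
  M : Set (Fin (m + 1) → ℝ)
  Xbar : Set (Fin n → ℝ)
  Tbar : Set (Fin (m + 1) → ℝ)

section DualAlgorithm

variable {n m : ℕ}

/-- The initial outer approximation `D_0` of the lower image. -/
def initialD (P : CVOP n m) (p : Params m) (s : InitState n m) : Set (Fin (m + 1) → ℝ) :=
  {t | wOf p.T t ∈ dualCone (cone s.YOut)} ∩
    ⋂ x ∈ s.Xbar, {t | 0 ≤ wOf p.T t ⬝ᵥ P.Γ x - t (Fin.last m)}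

/-- The additional test: the weighted sum problems are bounded for all extreme directions of
`(cone YOut)⁺`. -/
def dualTest (P : CVOP n m) (YOut : Set (Fin (m + 1) → ℝ)) : Prop :=
  ∀ w, IsExtremeDirection (dualCone (cone YOut)) w → P.P1Bounded w

/-- Processing a vertex `v` of the current outer approximation. -/
def processVertex (P : CVOP n m) (p : Params m) (ε : ℝ) (v : Fin (m + 1) → ℝ)
    (s s' : DualState n m) : Prop :=
  ∃ x, P.P1Optimal (wOf p.T v) x ∧
    ((ε < v (Fin.last m) - wOf p.T v ⬝ᵥ P.Γ x ∧
      s' = { s with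
        Xbar := insert x s.Xbar
        Tbar := insert (p.Tᵀ *ᵥ wOf p.T v) s.Tbar
        M := s.M ∩ {t | t (Fin.last m) ≤ wOf p.T t ⬝ᵥ P.Γ x} }) ∨
     (v (Fin.last m) - wOf p.T v ⬝ᵥ P.Γ x ≤ ε ∧
      s' = { s with
        Xbar := insert x s.Xbar
        Tbar := insert (p.Tᵀ *ᵥ wOf p.T v) s.Tbar }))

/-- One round of the main loop. -/
def dualBody (P : CVOP n m) (p : Params m) (ε : ℝ) (s s' : DualState n m) : Prop :=
  ∃ s₁ : DualState n m,
    ForEach (s.D.extremePoints ℝ) (processVertex P p ε) { s with M := univ } s₁ ∧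
    ((s₁.M ≠ univ ∧ s' = { s₁ with D := s₁.D ∩ s₁.M }) ∨ (s₁.M = univ ∧ s' = s₁))

/-- The dual algorithm terminates after passing the additional test, with output
`Xbar`, `YOut`, `Tbar`. -/
def DualAlgorithmOutputs (P : CVOP n m) (p : Params m) (ε δ : ℝ)
    (Xbar : Set (Fin n → ℝ)) (YOut Tbar : Set (Fin (m + 1) → ℝ)) : Prop :=
  ∃ s₀ : InitState n m, InitRun P p δ s₀ ∧ dualTest P s₀.YOut ∧
    ∃ s : DualState n m,
      While (fun a : DualState n m => a.M ≠ univ) (dualBody P p ε)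
        { D := initialD P p s₀, M := ∅, Xbar := s₀.Xbar, Tbar := s₀.Tbar } s ∧
      Xbar = s.Xbar ∧ YOut = s₀.YOut ∧ Tbar = s.Tbar

end DualAlgorithm

end

end UnboundedCVOP

namespace UnboundedCVOP

/-! ### Dot products, cones and dual cones -/

section ConvexGeometry

variable {q : ℕ}

/-! Points `t` of the dual image space encode halfspaces of the primal one: `w(t)` is the normal,
scaled by `w(t)ᵀc = 1`, and `t_q` the offset. The set `D` kept by the main loop contains every `t`
with `w(t) ∈ (cone Y)⁺` that satisfies `t_q ≤ w(t)ᵀΓ(x)` for all stored `x`. When the loop stops,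
every vertex `u` of `D` has `u_q - ε ≤ inf w(u)ᵀΓ`.

Vertices suffice. Since `c` is interior to `cone Y`, the section `{w ∈ (cone Y)⁺ | wᵀc = 1}` is
compact. Hence `D` is bounded in its first `q-1` coordinates and bounded above in the last, and lies
in the convex hull of its vertices minus `K` (`subset_convexHull_extremePoints_sub_coneK`). As `t ↦
w(t)` is affine, the estimate extends to all of `D` (`DualInvariant.last_sub_le`).

The two approximation claims follow. A point of the lower image lies in `D`, hence below a convex
combination of vertices, each at most `ε` above its dual value (`DualInvariant.lowerImage_subset`).
A point of the upper image outside the inner approximation would be separated from it; the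
separating functional, lifted by `ε`, is a point of `D`, and the estimate shows that it does not cut
into the upper image (`DualInvariant.upperImage_subset`).

Initialization supplies `Y`. By strong duality every cut uses a weight with an attained weighted sum
minimum (`Assumption.P1Optimal_of_P2Optimal`), so cuts keep all recession directions. Every vertex
of the truncated outer cone ends up in, or within `δ` of, the recession cone, and convexity spreads
this to the whole truncation (`InitInvariant.guarantee`). If no cut is ever made, the upper image is
the whole space and the modified dual problem is infeasible. -/

lemma continuous_dotProduct_left (w : Fin q → ℝ) : Continuous fun y : Fin q → ℝ => w ⬝ᵥ y := by
  unfold dotProduct; fun_prop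

lemma exists_eq_dotProduct (f : StrongDual ℝ (Fin q → ℝ)) :
    ∃ w : Fin q → ℝ, ∀ y, f y = w ⬝ᵥ y := by
  refine ⟨(dotProductEquiv ℝ (Fin q)).symm f.toLinearMap, fun y => ?_⟩
  have := LinearMap.congr_fun ((dotProductEquiv ℝ (Fin q)).apply_symm_apply f.toLinearMap) y
  exact this.symm

lemma exists_dotProduct_lt_of_notMem {A : Set (Fin q → ℝ)} (hA : Convex ℝ A) (hc : IsClosed A)
    {y : Fin q → ℝ} (hy : y ∉ A) : ∃ (w : Fin q → ℝ) (γ : ℝ), w ⬝ᵥ y < γ ∧ ∀ a ∈ A, γ < w ⬝ᵥ a := by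
  obtain ⟨f, γ, h1, h2⟩ := geometric_hahn_banach_point_closed hA hc hy
  obtain ⟨w, hw⟩ := exists_eq_dotProduct f
  exact ⟨w, γ, hw y ▸ h1, fun a ha => hw a ▸ h2 a ha⟩

/-- An affine function bounded below on a ray has nonnegative slope. This is what turns separating
functionals into elements of dual cones. -/
lemma nonneg_of_forall_lt_mul {a b γ : ℝ} (h : ∀ k : ℝ, 0 ≤ k → γ < b + k * a) : 0 ≤ a := by
  by_contra! ha
  have := h ((|b - γ|) / (-a)) (div_nonneg (abs_nonneg _) (by linarith))
  have h2 : |b - γ| / (-a) * a = -|b - γ| := by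
    rw [div_mul_eq_mul_div, div_neg, mul_div_cancel_right₀ _ ha.ne]
  rw [h2] at this
  linarith [le_abs_self (b - γ)]

lemma subset_cone (Y : Set (Fin q → ℝ)) : Y ⊆ cone Y := PointedCone.subset_hull

lemma zero_mem_cone (Y : Set (Fin q → ℝ)) : (0 : Fin q → ℝ) ∈ cone Y :=
  (PointedCone.hull ℝ Y).zero_mem

lemma add_mem_cone {Y : Set (Fin q → ℝ)} {a b : Fin q → ℝ} (ha : a ∈ cone Y) (hb : b ∈ cone Y) :
    a + b ∈ cone Y :=
  (PointedCone.hull ℝ Y).add_mem ha hb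

lemma smul_mem_cone {Y : Set (Fin q → ℝ)} {a : Fin q → ℝ} {k : ℝ} (hk : 0 ≤ k) (ha : a ∈ cone Y) :
    k • a ∈ cone Y :=
  (PointedCone.hull ℝ Y).smul_mem hk ha

lemma convex_cone (Y : Set (Fin q → ℝ)) : Convex ℝ (cone Y) :=
  fun _ hx _ hy _ _ ha hb _ => add_mem_cone (smul_mem_cone ha hx) (smul_mem_cone hb hy)

/-- The conic hull is contained in each convex cone containing the set. -/
lemma cone_subset {Y A : Set (Fin q → ℝ)} (h0 : 0 ∈ A) (hadd : ∀ a ∈ A, ∀ b ∈ A, a + b ∈ A)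
    (hsmul : ∀ k : ℝ, 0 ≤ k → ∀ a ∈ A, k • a ∈ A) (hY : Y ⊆ A) : cone Y ⊆ A := by
  intro y hy
  refine Submodule.span_induction (R := {c : ℝ // 0 ≤ c}) (p := fun y _ => y ∈ A)
    (fun y hy => hY hy) h0 (fun a b _ _ ha hb => hadd a ha b hb)
    (fun k a _ ha => hsmul k k.2 a ha) hy

lemma convex_dualCone (A : Set (Fin q → ℝ)) : Convex ℝ (dualCone A) := by
  intro x hx y hy a b ha hb _ z hz
  have h1 := hx z hz
  have h2 := hy z hz
  rw [add_dotProduct, smul_dotProduct, smul_dotProduct]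
  exact add_nonneg (mul_nonneg ha h1) (mul_nonneg hb h2)

lemma isClosed_dualCone (A : Set (Fin q → ℝ)) : IsClosed (dualCone A) := by
  have : dualCone A = ⋂ a ∈ A, {z | 0 ≤ z ⬝ᵥ a} := by ext; simp [dualCone]
  rw [this]
  refine isClosed_biInter fun a _ => isClosed_le continuous_const ?_
  simpa only [dotProduct_comm _ a] using continuous_dotProduct_left a

lemma dualCone_anti {A B : Set (Fin q → ℝ)} (h : A ⊆ B) : dualCone B ⊆ dualCone A :=
  fun _ hz a ha => hz a (h ha)

lemma mem_dualCone_cone {Y : Set (Fin q → ℝ)} {z : Fin q → ℝ} (h : ∀ y ∈ Y, 0 ≤ z ⬝ᵥ y) :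
    z ∈ dualCone (cone Y) := by
  intro a ha
  refine cone_subset (A := {a | 0 ≤ z ⬝ᵥ a}) (by simp) ?_ ?_ h ha
  · intro a ha b hb
    simpa [dotProduct_add] using add_nonneg ha hb
  · intro k hk a ha
    simpa [dotProduct_smul] using mul_nonneg hk ha

/-- A point outside a closed convex cone is separated from it by an element of the dual cone. -/
lemma exists_mem_dualCone_neg {A : PointedCone ℝ (Fin q → ℝ)}
    (hA : IsClosed (A : Set (Fin q → ℝ))) {y : Fin q → ℝ} (hy : y ∉ A) :
    ∃ w ∈ dualCone (A : Set (Fin q → ℝ)), w ⬝ᵥ y < 0 := by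
  have hconv : Convex ℝ (A : Set (Fin q → ℝ)) := A.convex
  obtain ⟨w, γ, h1, h2⟩ := exists_dotProduct_lt_of_notMem hconv hA hy
  have h0 := h2 0 A.zero_mem
  rw [dotProduct_zero] at h0
  refine ⟨w, fun a ha => ?_, by linarith⟩
  refine nonneg_of_forall_lt_mul (γ := γ) (b := 0) fun k hk => ?_
  have := h2 (k • a) (A.smul_mem hk ha)
  simpa [dotProduct_smul] using this

/-- A nonzero element of the dual cone is positive on interior points. -/
lemma dotProduct_pos_of_mem_interior {A : Set (Fin q → ℝ)} {w c : Fin q → ℝ} (hw : w ∈ dualCone A)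
    (h0 : w ≠ 0) (hc : c ∈ interior A) : 0 < w ⬝ᵥ c := by
  -- For small `η > 0` the point `c - η w` is still in `A`, so `wᵀc ≥ η wᵀw > 0`.
  have hev : ∀ᶠ η : ℝ in nhdsWithin 0 (Ioi 0), c - η • w ∈ A := by
    have : Filter.Tendsto (fun η : ℝ => c - η • w) (nhdsWithin 0 (Ioi 0)) (nhds c) := by
      have h : Continuous fun η : ℝ => c - η • w := by fun_prop
      simpa using (h.tendsto 0).mono_left nhdsWithin_le_nhds
    exact this (mem_interior_iff_mem_nhds.1 hc)
  obtain ⟨η, hη, hpos⟩ := (hev.and self_mem_nhdsWithin).exists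
  have hpos : 0 < η := hpos
  have h1 := hw _ hη
  rw [dotProduct_sub, dotProduct_smul, smul_eq_mul] at h1
  have h2 : 0 < w ⬝ᵥ w := lt_of_le_of_ne
    (Finset.sum_nonneg fun i _ => mul_self_nonneg _)
    (Ne.symm (by rwa [Ne, dotProduct_self_eq_zero]))
  nlinarith [mul_pos hpos h2]

/-- The section `{w ∈ A⁺ | wᵀc = 1}` of a dual cone is bounded if `c` is an interior point. -/
lemma isCompact_dualCone_section {A : Set (Fin q → ℝ)} {c : Fin q → ℝ} (hc : c ∈ interior A) :
    IsCompact {w | w ∈ dualCone A ∧ w ⬝ᵥ c = 1} := by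
  refine Metric.isCompact_of_isClosed_isBounded ?_ ?_
  · refine (isClosed_dualCone A).inter (isClosed_eq ?_ continuous_const)
    simpa only [dotProduct_comm _ c] using continuous_dotProduct_left c
  · obtain ⟨ρ, hρ, hball⟩ := Metric.nhds_basis_closedBall.mem_iff.1 (mem_interior_iff_mem_nhds.1 hc)
    refine isBounded_iff_forall_norm_le.2 ⟨1 / ρ, fun w ⟨hw, hwc⟩ => ?_⟩
    -- Testing `w` on `c ± ρ eᵢ` gives `1 ± ρ wᵢ ≥ 0`, hence `|wᵢ| ≤ 1/ρ`.
    have key : ∀ (i : Fin q) (s : ℝ), |s| = ρ → 0 ≤ 1 + w i * s := by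
      intro i s hs
      have hmem : c + Pi.single i s ∈ A := by
        apply hball
        rw [Metric.mem_closedBall, dist_eq_norm, add_sub_cancel_left, Pi.norm_single,
          Real.norm_eq_abs, hs]
      have := hw _ hmem
      rwa [dotProduct_add, hwc, dotProduct_single] at this
    refine (pi_norm_le_iff_of_nonneg (by positivity)).2 fun i => ?_
    rw [Real.norm_eq_abs, le_div_iff₀ hρ, ← abs_of_pos hρ, ← abs_mul]
    have h1 := key i ρ (abs_of_pos hρ)
    have h2 := key i (-ρ) (by rw [abs_neg, abs_of_pos hρ])
    rw [abs_le]
    constructor <;> linarith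

/-! ### The `ℓ₁` norm -/

lemma l1norm_zero : l1norm (0 : Fin q → ℝ) = 0 := by simp [l1norm]

lemma l1norm_smul (k : ℝ) (y : Fin q → ℝ) : l1norm (k • y) = |k| * l1norm y := by
  simp [l1norm, abs_mul, Finset.mul_sum]

lemma l1norm_add_le (x y : Fin q → ℝ) : l1norm (x + y) ≤ l1norm x + l1norm y := by
  unfold l1norm
  rw [← Finset.sum_add_distrib]
  exact Finset.sum_le_sum fun i _ => abs_add_le _ _

lemma l1norm_neg (y : Fin q → ℝ) : l1norm (-y) = l1norm y := by simp [l1norm]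

lemma l1norm_pos {y : Fin q → ℝ} (hy : y ≠ 0) : 0 < l1norm y := by
  obtain ⟨i, hi⟩ := Function.ne_iff.1 hy
  exact Finset.sum_pos' (fun _ _ => abs_nonneg _) ⟨i, Finset.mem_univ _, abs_pos.2 hi⟩

lemma continuous_l1norm : Continuous (l1norm : (Fin q → ℝ) → ℝ) := by
  unfold l1norm; fun_prop

lemma convexOn_l1norm : ConvexOn ℝ univ (l1norm : (Fin q → ℝ) → ℝ) := by
  refine ⟨convex_univ, fun x _ y _ a b ha hb _ => ?_⟩
  refine (l1norm_add_le _ _).trans_eq ?_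
  rw [l1norm_smul, l1norm_smul, abs_of_nonneg ha, abs_of_nonneg hb]
  rfl

lemma edist_toLp_one (x y : Fin q → ℝ) :
    edist (WithLp.toLp 1 x : PiLp 1 fun _ : Fin q => ℝ) (WithLp.toLp 1 y) =
      ENNReal.ofReal (l1norm (x - y)) := by
  rw [edist_dist, dist_eq_norm, PiLp.norm_eq_of_L1]
  simp [l1norm]

lemma isCompact_l1Ball : IsCompact (l1Ball q) := by
  refine Metric.isCompact_of_isClosed_isBounded
    (isClosed_le continuous_l1norm continuous_const) ?_
  refine isBounded_iff_forall_norm_le.2 ⟨1, fun y hy => ?_⟩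
  refine (pi_norm_le_iff_of_nonneg zero_le_one).2 fun i => ?_
  refine le_trans ?_ (show l1norm y ≤ 1 from hy)
  exact Finset.single_le_sum (f := fun i => |y i|) (fun _ _ => abs_nonneg _) (Finset.mem_univ i)

lemma convex_l1Ball : Convex ℝ (l1Ball q) := by
  simpa [l1Ball] using (convexOn_l1norm (q := q)).convex_le 1

/-- The `ℓ₁` ball is cut out by the sign vectors. -/
lemma mem_l1Ball_iff (y : Fin q → ℝ) :
    y ∈ l1Ball q ↔ ∀ s ∈ Set.pi univ fun _ : Fin q => ({1, -1} : Set ℝ), -1 ≤ s ⬝ᵥ y := by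
  constructor
  · intro hy s hs
    have hy : ∑ i, |y i| ≤ 1 := hy
    have : -∑ i, |y i| ≤ s ⬝ᵥ y := by
      rw [← Finset.sum_neg_distrib]
      refine Finset.sum_le_sum fun i _ => ?_
      rcases hs i (mem_univ i) with h | h
      · rw [h, one_mul]; exact neg_abs_le _
      · rw [h]; linarith [le_abs_self (y i)]
    linarith
  · intro h
    have := h (fun i => if 0 ≤ y i then -1 else 1) fun i _ => by dsimp only; split_ifs <;> simp
    have h2 : (fun i => if 0 ≤ y i then (-1 : ℝ) else 1) ⬝ᵥ y = -l1norm y := by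
      unfold dotProduct l1norm
      rw [← Finset.sum_neg_distrib]
      refine Finset.sum_congr rfl fun i _ => ?_
      dsimp only
      split_ifs with hi
      · rw [abs_of_nonneg hi]; ring
      · rw [abs_of_neg (not_le.1 hi)]; ring
    rw [h2] at this
    exact neg_le_neg_iff.1 this

/-! ### Extreme points of polyhedra -/

/-- An intersection of finitely many halfspaces has finitely many extreme points. -/
lemma finite_extremePoints_of_halfspaces {F : Set ((Fin q → ℝ) × ℝ)} (hF : F.Finite) :
    ({y | ∀ f ∈ F, f.2 ≤ f.1 ⬝ᵥ y}.extremePoints ℝ).Finite := by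
  set A : Set (Fin q → ℝ) := {y | ∀ f ∈ F, f.2 ≤ f.1 ⬝ᵥ y} with hA
  -- An extreme point is determined by its set of active constraints. If `x` and `y` have the same
  -- active set, then `x` can be moved slightly away from `y` within `A`, so `x` lies strictly
  -- between two points of `A` unless `x = y`.
  refine Set.Finite.of_injOn (f := fun x => {f ∈ F | f.1 ⬝ᵥ x = f.2}) (t := 𝒫 F)
    (fun x _ => sep_subset _ _) ?_ hF.finite_subsets
  intro x hx y hy hxy
  have hev : ∀ᶠ η : ℝ in nhdsWithin 0 (Ioi 0), ∀ f ∈ F, f.2 ≤ f.1 ⬝ᵥ (x + η • (x - y)) := by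
    refine (Filter.eventually_all_finite hF).2 fun f hf => ?_
    by_cases hact : f.1 ⬝ᵥ x = f.2
    · have hmem : f ∈ {f ∈ F | f.1 ⬝ᵥ y = f.2} := by
        rw [← show _ = {f ∈ F | f.1 ⬝ᵥ y = f.2} from hxy]; exact ⟨hf, hact⟩
      refine Filter.Eventually.of_forall fun η => ?_
      rw [dotProduct_add, dotProduct_smul, dotProduct_sub, hact, hmem.2]
      simp
    · have hlt : f.2 < f.1 ⬝ᵥ x := lt_of_le_of_ne (hx.1 f hf) (Ne.symm hact)
      have hcont : Continuous fun η : ℝ => f.1 ⬝ᵥ (x + η • (x - y)) :=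
        (continuous_dotProduct_left f.1).comp (by fun_prop)
      have := (hcont.tendsto 0).mono_left (nhdsWithin_le_nhds (s := Ioi 0))
      simp only [zero_smul, add_zero] at this
      exact (this.eventually (lt_mem_nhds hlt)).mono fun _ h => h.le
  obtain ⟨η, hη, hpos⟩ := (hev.and self_mem_nhdsWithin).exists
  have hpos : 0 < η := hpos
  refine (((mem_extremePoints.1 hx).2 _ hη y hy.1 ?_).2).symm
  refine ⟨1 / (1 + η), η / (1 + η), by positivity, by positivity, by field_simp, ?_⟩
  ext i
  simp only [Pi.add_apply, Pi.smul_apply, Pi.sub_apply, smul_eq_mul]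
  field_simp
  ring

/-! ### Vertices of truncated polyhedral cones -/

section OuterDirections

variable {W : Set (Fin q → ℝ)}

lemma finite_extremePoints_dualCone_inter_l1Ball (hW : W.Finite) :
    ((dualCone W ∩ l1Ball q).extremePoints ℝ).Finite := by
  have : dualCone W ∩ l1Ball q = {y | ∀ f ∈ (fun w => (w, (0 : ℝ))) '' W ∪
      (fun s => (s, (-1 : ℝ))) '' (Set.pi univ fun _ : Fin q => ({1, -1} : Set ℝ)),
      f.2 ≤ f.1 ⬝ᵥ y} := by
    ext y
    rw [mem_inter_iff, mem_l1Ball_iff]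
    simp only [union_def, mem_ofPred_eq, or_imp, forall_and, forall_mem_image, dualCone,
      dotProduct_comm y]
  rw [this]
  refine finite_extremePoints_of_halfspaces ((hW.image _).union (Set.Finite.image _ ?_))
  exact Set.Finite.pi fun _ => by simp

/-- Krein–Milman for a compact convex set; no closure is needed because there are only finitely many
extreme points. -/
lemma convexHull_extremePoints_dualCone_inter_l1Ball (hW : W.Finite) :
    convexHull ℝ ((dualCone W ∩ l1Ball q).extremePoints ℝ) = dualCone W ∩ l1Ball q := by
  rw [← ((finite_extremePoints_dualCone_inter_l1Ball hW).isClosed_convexHull ℝ).closure_eq]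
  exact closure_convexHull_extremePoints (isCompact_l1Ball.inter_left (isClosed_dualCone W))
    ((convex_dualCone W).inter convex_l1Ball)

/-- Each nonzero ray of the cone meets the unit sphere, where its point is a convex combination of
vertices; the vertex `0` contributes nothing. -/
lemma cone_extremePoints_dualCone_inter_l1Ball (hW : W.Finite) :
    cone ((dualCone W ∩ l1Ball q).extremePoints ℝ \ {0}) = dualCone W := by
  set V := (dualCone W ∩ l1Ball q).extremePoints ℝ with hV
  apply Subset.antisymm
  · refine cone_subset (fun a _ => by simp) (fun a ha b hb w hw => ?_)
      (fun k hk a ha w hw => ?_) fun y hy => (extremePoints_subset hy.1).1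
    · rw [add_dotProduct]; exact add_nonneg (ha w hw) (hb w hw)
    · rw [smul_dotProduct]; exact mul_nonneg hk (ha w hw)
  · have hsub : convexHull ℝ V ⊆ cone (V \ {0}) := by
      refine convexHull_min (fun y hy => ?_) (convex_cone _)
      by_cases h0 : y = 0
      · rw [h0]; exact zero_mem_cone _
      · exact subset_cone _ ⟨hy, h0⟩
    rw [convexHull_extremePoints_dualCone_inter_l1Ball hW] at hsub
    intro y hy
    by_cases h0 : y = 0
    · rw [h0]; exact zero_mem_cone _
    · have hpos := l1norm_pos h0
      have hmem : (l1norm y)⁻¹ • y ∈ dualCone W ∩ l1Ball q := by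
        refine ⟨fun w hw => ?_, ?_⟩
        · rw [smul_dotProduct]; exact mul_nonneg (inv_nonneg.2 hpos.le) (hy w hw)
        · change l1norm _ ≤ 1
          rw [l1norm_smul, abs_of_pos (inv_pos.2 hpos), inv_mul_cancel₀ hpos.ne']
      have := smul_mem_cone hpos.le (hsub hmem)
      rwa [smul_inv_smul₀ hpos.ne'] at this

end OuterDirections

end ConvexGeometry

/-! ### Sets bounded above in the last coordinate -/

lemma convex_coneK (m : ℕ) : Convex ℝ (coneK m) := by
  rintro _ ⟨k, hk, rfl⟩ _ ⟨l, hl, rfl⟩ a b ha hb _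
  refine ⟨a * k + b * l, by positivity, ?_⟩
  rw [Pi.single_add, ← Pi.single_smul, ← Pi.single_smul, smul_eq_mul, smul_eq_mul]

lemma isClosed_coneK (m : ℕ) : IsClosed (coneK m) := by
  have : coneK m = {y | 0 ≤ y (Fin.last m)} ∩
      {y | y = Pi.single (Fin.last m) (y (Fin.last m))} := by
    ext y
    constructor
    · rintro ⟨k, hk, rfl⟩
      simpa using hk
    · rintro ⟨h1, h2⟩
      exact ⟨_, h1, h2⟩
  rw [this]
  refine (isClosed_le continuous_const (continuous_apply _)).inter (isClosed_eq continuous_id ?_)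
  exact (continuous_single (A := fun _ : Fin (m + 1) => ℝ) (Fin.last m)).comp (continuous_apply _)

/-- A functional with positive last coefficient attains its maximum over `D` at an extreme point. -/
lemma exists_extremePoint_dotProduct_le {m : ℕ} {D : Set (Fin (m + 1) → ℝ)} (hDc : IsClosed D)
    {B : ℝ} (hB : ∀ t ∈ D, ∀ i, i ≠ Fin.last m → |t i| ≤ B) (hB' : ∀ t ∈ D, t (Fin.last m) ≤ B)
    {g : Fin (m + 1) → ℝ} (hg : 0 < g (Fin.last m)) {t₀ : Fin (m + 1) → ℝ} (ht₀ : t₀ ∈ D) :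
    ∃ u ∈ D.extremePoints ℝ, g ⬝ᵥ t₀ ≤ g ⬝ᵥ u := by
  -- The superlevel set of `g` is compact: the other coordinates are bounded, and the positive last
  -- coefficient turns the bound on `g` into a lower bound for the last coordinate.
  set S : Set (Fin (m + 1) → ℝ) := D ∩ {t | g ⬝ᵥ t₀ ≤ g ⬝ᵥ t} with hS
  have hScomp : IsCompact S := by
    refine Metric.isCompact_of_isClosed_isBounded
      (hDc.inter (isClosed_le continuous_const (continuous_dotProduct_left g))) ?_
    set b := g (Fin.last m) with hb
    set L := ∑ i : Fin m, |g i.castSucc| * B with hL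
    refine isBounded_iff_forall_norm_le.2 ⟨|B| + |(g ⬝ᵥ t₀ - L) / b|, fun t ht => ?_⟩
    refine (pi_norm_le_iff_of_nonneg (by positivity)).2 fun i => ?_
    rw [Real.norm_eq_abs]
    by_cases hi : i = Fin.last m
    · subst hi
      have h1 := hB' t ht.1
      have h2 : g ⬝ᵥ t ≤ L + b * t (Fin.last m) := by
        unfold dotProduct
        rw [Fin.sum_univ_castSucc]
        refine add_le_add (Finset.sum_le_sum fun i _ => ?_) le_rfl
        refine (le_abs_self _).trans ?_
        rw [abs_mul]
        exact mul_le_mul_of_nonneg_left (hB t ht.1 _ (Fin.castSucc_lt_last i).ne) (abs_nonneg _)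
      have h3 : (g ⬝ᵥ t₀ - L) / b ≤ t (Fin.last m) := by
        rw [div_le_iff₀ hg]
        have : g ⬝ᵥ t₀ ≤ g ⬝ᵥ t := ht.2
        linarith
      rw [abs_le]
      constructor
      · linarith [neg_abs_le ((g ⬝ᵥ t₀ - L) / b), abs_nonneg B]
      · linarith [le_abs_self B, abs_nonneg ((g ⬝ᵥ t₀ - L) / b)]
    · exact (hB t ht.1 i hi).trans (by linarith [le_abs_self B, abs_nonneg ((g ⬝ᵥ t₀ - L) / b)])
  obtain ⟨t₁, ht₁, hmax⟩ := hScomp.exists_isMaxOn ⟨t₀, ht₀, le_refl (g ⬝ᵥ t₀)⟩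
    (continuous_dotProduct_left g).continuousOn
  let l : StrongDual ℝ (Fin (m + 1) → ℝ) := LinearMap.toContinuousLinearMap (dotProductEquiv ℝ _ g)
  have hl : ∀ t, l t = g ⬝ᵥ t := fun t => rfl
  have ht₁max : ∀ t ∈ D, g ⬝ᵥ t ≤ g ⬝ᵥ t₁ := by
    intro t ht
    by_cases h : g ⬝ᵥ t₀ ≤ g ⬝ᵥ t
    · exact hmax ⟨ht, h⟩
    · exact (not_le.1 h).le.trans ht₁.2
  have hexp : IsExposed ℝ D (l.toExposed D) := ContinuousLinearMap.toExposed.isExposed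
  have hEcomp : IsCompact (l.toExposed D) := by
    refine hScomp.of_isClosed_subset ?_ fun t ht => ⟨ht.1, ht.2 t₀ ht₀⟩
    exact hexp.isClosed hDc
  obtain ⟨u, hu⟩ := hEcomp.extremePoints_nonempty ⟨t₁, ht₁.1, ht₁max⟩
  exact ⟨u, hexp.isExtreme.extremePoints_subset_extremePoints hu,
    (extremePoints_subset hu).2 t₀ ht₀⟩

/-- A functional separating a point from the right-hand side is nonpositive along `e^q`, but
possibly zero there. A small multiple of `e^q` makes it suitable for
`exists_extremePoint_dotProduct_le` without using up the separation gap. -/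
lemma subset_convexHull_extremePoints_sub_coneK {m : ℕ} {D : Set (Fin (m + 1) → ℝ)}
    (hDc : IsClosed D) {B : ℝ} (hB : ∀ t ∈ D, ∀ i, i ≠ Fin.last m → |t i| ≤ B)
    (hB' : ∀ t ∈ D, t (Fin.last m) ≤ B) (hfin : (D.extremePoints ℝ).Finite) :
    D ⊆ convexHull ℝ (D.extremePoints ℝ) - coneK m := by
  intro t₀ ht₀
  by_contra hnot
  have hconv : Convex ℝ (convexHull ℝ (D.extremePoints ℝ) - coneK m) :=
    (convex_convexHull ℝ _).sub (convex_coneK m)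
  have hclosed : IsClosed (convexHull ℝ (D.extremePoints ℝ) - coneK m) := by
    rw [sub_eq_add_neg]
    exact (isClosed_coneK m).neg.add_left_of_isCompact (hfin.isCompact_convexHull ℝ)
  obtain ⟨w, γ, h1, h2⟩ := exists_dotProduct_lt_of_notMem hconv hclosed hnot
  set e : Fin (m + 1) → ℝ := Pi.single (Fin.last m) 1 with he
  have hext : ∀ u ∈ D.extremePoints ℝ, ∀ k : ℝ, 0 ≤ k → γ < w ⬝ᵥ u + k * -w (Fin.last m) := by
    intro u hu k hk
    have := h2 (u - Pi.single (Fin.last m) k)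
      (sub_mem_sub (subset_convexHull ℝ _ hu) ⟨k, hk, rfl⟩)
    rw [dotProduct_sub, dotProduct_single] at this
    linarith
  obtain ⟨u₀, hu₀, -⟩ := exists_extremePoint_dotProduct_le hDc hB hB' (g := e) (by simp [he]) ht₀
  have hneg := nonneg_of_forall_lt_mul (hext u₀ hu₀)
  -- `η` is so small that the perturbation changes values by less than the gap `γ - wᵀt₀`, given the
  -- upper bound `B` on the last coordinate.
  obtain ⟨η, hη, hlt⟩ : ∃ η : ℝ, 0 < η ∧ η * (B - t₀ (Fin.last m)) < γ - w ⬝ᵥ t₀ := by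
    have hnn : 0 ≤ B - t₀ (Fin.last m) := sub_nonneg.2 (hB' t₀ ht₀)
    refine ⟨(γ - w ⬝ᵥ t₀) / (B - t₀ (Fin.last m) + 1), div_pos (by linarith) (by linarith), ?_⟩
    rw [div_mul_eq_mul_div, div_lt_iff₀ (by linarith)]
    nlinarith
  obtain ⟨u, hu, hle⟩ := exists_extremePoint_dotProduct_le hDc hB hB' (g := η • e - w)
    (by simp [he]; linarith) ht₀
  have hγ := hext u hu 0 le_rfl
  simp only [sub_dotProduct, smul_dotProduct, he, single_dotProduct, smul_eq_mul, one_mul] at hle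
  have := mul_le_mul_of_nonneg_left (hB' u (extremePoints_subset hu)) hη.le
  linarith

/-! ### Recession cones -/

section Recession

variable {q : ℕ} {A : Set (Fin q → ℝ)}

lemma zero_mem_recessionCone : (0 : Fin q → ℝ) ∈ recessionCone A :=
  fun y hy α _ => by simpa using hy

lemma add_mem_recessionCone {d e : Fin q → ℝ} (hd : d ∈ recessionCone A)
    (he : e ∈ recessionCone A) : d + e ∈ recessionCone A := fun y hy α hα => by
  rw [smul_add, ← add_assoc]
  exact he _ (hd y hy α hα) α hα

lemma smul_mem_recessionCone {d : Fin q → ℝ} {k : ℝ} (hk : 0 ≤ k) (hd : d ∈ recessionCone A) :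
    k • d ∈ recessionCone A := fun y hy α hα => by
  rw [smul_smul]
  exact hd y hy _ (mul_nonneg hα hk)

lemma convex_recessionCone : Convex ℝ (recessionCone A) := fun _ hx _ hy _ _ ha hb _ =>
  add_mem_recessionCone (smul_mem_recessionCone ha hx) (smul_mem_recessionCone hb hy)

lemma eq_univ_of_recessionCone_eq_univ (hA : A.Nonempty) (h : recessionCone A = univ) :
    A = univ := by
  obtain ⟨y, hy⟩ := hA
  refine eq_univ_of_forall fun z => ?_
  have hz : z - y ∈ recessionCone A := h ▸ mem_univ _
  simpa using hz y hy 1 zero_le_one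

lemma dotProduct_nonneg_of_mem_recessionCone (hA : A.Nonempty) {w d : Fin q → ℝ} {γ : ℝ}
    (hw : ∀ y ∈ A, γ ≤ w ⬝ᵥ y) (hd : d ∈ recessionCone A) : 0 ≤ w ⬝ᵥ d := by
  obtain ⟨y, hy⟩ := hA
  refine nonneg_of_forall_lt_mul (γ := γ - 1) (b := w ⬝ᵥ y) fun k hk => ?_
  have := hw _ (hd y hy k hk)
  rw [dotProduct_add, dotProduct_smul, smul_eq_mul] at this
  linarith

lemma exists_dotProduct_le_of_notMem_interior (hA : Convex ℝ A) (hint : (interior A).Nonempty)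
    {y : Fin q → ℝ} (hy : y ∉ interior A) : ∃ w : Fin q → ℝ, w ≠ 0 ∧ ∀ a ∈ A, w ⬝ᵥ y ≤ w ⬝ᵥ a := by
  obtain ⟨f, hf, h⟩ := geometric_hahn_banach_of_nonempty_interior_point hA hy hint
  obtain ⟨w, hw⟩ := exists_eq_dotProduct f
  refine ⟨-w, fun h0 => hf ?_, fun a ha => ?_⟩
  · ext y
    rw [hw, neg_eq_zero.1 h0]
    simp
  · have := h a ha
    rw [hw, hw] at this
    simpa using this

/-- The sum of a finite generating set of a solid convex cone is an interior point. -/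
lemma sum_mem_interior_cone {R : Finset (Fin q → ℝ)}
    (hint : (interior (cone (R : Set (Fin q → ℝ)))).Nonempty) :
    ∑ d ∈ R, d ∈ interior (cone (R : Set (Fin q → ℝ))) := by
  -- A supporting functional at the sum would be nonnegative on each generator and nonpositive on
  -- the sum, hence zero on the whole cone, although it is positive at interior points.
  by_contra hnot
  obtain ⟨w, hw0, hw⟩ := exists_dotProduct_le_of_notMem_interior (convex_cone _) hint hnot
  have hwR : ∀ a ∈ cone (R : Set (Fin q → ℝ)), 0 ≤ w ⬝ᵥ a := fun a ha =>
    nonneg_of_forall_lt_mul (γ := w ⬝ᵥ (∑ d ∈ R, d) - 1) (b := 0) fun k hk => by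
      have := hw _ (smul_mem_cone hk ha)
      rw [dotProduct_smul, smul_eq_mul] at this
      linarith
  have hsum : ∑ d ∈ R, w ⬝ᵥ d ≤ 0 := by
    rw [← dotProduct_sum]
    simpa using hw 0 (zero_mem_cone _)
  have hzero : ∀ d ∈ R, w ⬝ᵥ d = 0 :=
    (Finset.sum_eq_zero_iff_of_nonneg fun d hd => hwR d (subset_cone _ hd)).1
      (le_antisymm hsum (Finset.sum_nonneg fun d hd => hwR d (subset_cone _ hd)))
  obtain ⟨c, hc⟩ := hint
  have hpos := dotProduct_pos_of_mem_interior (A := cone (R : Set (Fin q → ℝ))) hwR hw0 hc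
  have hneg : -w ∈ dualCone (cone (R : Set (Fin q → ℝ))) :=
    mem_dualCone_cone fun d hd => by rw [neg_dotProduct, hzero d hd, neg_zero]
  have := hneg c (interior_subset hc)
  rw [neg_dotProduct] at this
  linarith

end Recession

/-! ### The upper image -/

namespace CVOP

variable {n m : ℕ} {P : CVOP n m}

lemma Assumption.X_nonempty (hP : P.Assumption) : P.X.Nonempty := hP.X_interior.mono interior_subset

lemma image_subset_upperImage {x : Fin n → ℝ} (hx : x ∈ P.X) : P.Γ x ∈ P.upperImage :=
  subset_closure ⟨P.Γ x, ⟨x, hx, rfl⟩, 0, P.C.zero_mem, add_zero _⟩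

lemma Assumption.upperImage_nonempty (hP : P.Assumption) : P.upperImage.Nonempty :=
  let ⟨_, hx⟩ := hP.X_nonempty
  ⟨_, image_subset_upperImage hx⟩

lemma Assumption.convex_image_add_cone (hP : P.Assumption) :
    Convex ℝ (P.Γ '' P.X + (P.C : Set (Fin (m + 1) → ℝ))) := by
  rintro _ ⟨_, ⟨x, hx, rfl⟩, k, hk, rfl⟩ _ ⟨_, ⟨y, hy, rfl⟩, l, hl, rfl⟩ a b ha hb hab
  obtain rfl : b = 1 - a := by linarith
  refine ⟨_, ⟨a • x + (1 - a) • y, hP.X_convex hx hy ha hb hab, rfl⟩,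
    (a • P.Γ x + (1 - a) • P.Γ y - P.Γ (a • x + (1 - a) • y)) + (a • k + (1 - a) • l),
    P.C.add_mem (hP.Γ_convex x hx y hy a ha (by linarith))
      (P.C.add_mem (P.C.smul_mem ha hk) (P.C.smul_mem hb hl)), ?_⟩
  simp only [smul_add]
  abel

lemma Assumption.convex_upperImage (hP : P.Assumption) : Convex ℝ P.upperImage :=
  hP.convex_image_add_cone.closure

lemma isClosed_upperImage : IsClosed P.upperImage := isClosed_closure

lemma cone_subset_recessionCone_upperImage :
    (P.C : Set (Fin (m + 1) → ℝ)) ⊆ recessionCone P.upperImage := by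
  intro d hd y hy α hα
  refine map_mem_closure (f := fun y => y + α • d) (by fun_prop) hy ?_
  rintro _ ⟨a, ha, k, hk, rfl⟩
  exact ⟨a, ha, k + α • d, P.C.add_mem hk (P.C.smul_mem hα hd), by simp [add_assoc]⟩

lemma le_dotProduct_of_mem_upperImage {w : Fin (m + 1) → ℝ} {γ : ℝ}
    (hw : w ∈ dualCone (P.C : Set (Fin (m + 1) → ℝ))) (h : ∀ x ∈ P.X, γ ≤ w ⬝ᵥ P.Γ x) :
    ∀ y ∈ P.upperImage, γ ≤ w ⬝ᵥ y := by
  refine fun y hy => closure_minimal (t := {y | γ ≤ w ⬝ᵥ y}) ?_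
    (isClosed_le continuous_const (continuous_dotProduct_left w)) hy
  rintro _ ⟨_, ⟨x, hx, rfl⟩, k, hk, rfl⟩
  change γ ≤ w ⬝ᵥ (P.Γ x + k)
  rw [dotProduct_add]
  linarith [h x hx, hw k hk]

/-- The optimal value bounds `w` below on the upper image; hence cuts with such weights never remove
recession directions. -/
lemma P1Optimal.dotProduct_nonneg {w d : Fin (m + 1) → ℝ} {x : Fin n → ℝ} (h : P.P1Optimal w x)
    (hw : w ∈ dualCone (P.C : Set (Fin (m + 1) → ℝ))) (hd : d ∈ recessionCone P.upperImage) :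
    0 ≤ w ⬝ᵥ d :=
  dotProduct_nonneg_of_mem_recessionCone ⟨_, image_subset_upperImage h.1⟩
    (le_dotProduct_of_mem_upperImage hw h.2) hd

lemma P1Optimal.isWeakMinimizer {w : Fin (m + 1) → ℝ} {x : Fin n → ℝ} (h : P.P1Optimal w x)
    (hw : w ∈ dualCone (P.C : Set (Fin (m + 1) → ℝ))) (h0 : w ≠ 0) : P.IsWeakMinimizer x := by
  refine ⟨h.1, eq_empty_iff_forall_notMem.2 ?_⟩
  rintro _ ⟨⟨_, rfl, k, hk, rfl⟩, x', hx', he⟩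
  have h1 := h.2 x' hx'
  have h2 := dotProduct_pos_of_mem_interior hw h0 hk
  rw [he] at h1
  simp only [dotProduct_sub] at h1
  linarith

/-- A direction in which the Pascoletti-Serafini problem is unbounded is a recession direction. -/
lemma Assumption.mem_recessionCone_of_P2Unbounded (hP : P.Assumption) {v d : Fin (m + 1) → ℝ}
    (h : P.P2Unbounded v d) : d ∈ recessionCone P.upperImage := by
  intro y hy α hα
  have hz : ∀ k : ℕ, ∃ z : ℝ, max (k : ℝ) (α + 1) < z ∧ v + z • d ∈ P.upperImage := by
    intro k
    by_contra! hcon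
    refine h ⟨max (k : ℝ) (α + 1), ?_⟩
    rintro z ⟨x, hx, hC⟩
    by_contra! hlt
    exact hcon z hlt (subset_closure ⟨P.Γ x, ⟨x, hx, rfl⟩, _, hC, by simp⟩)
  choose z hz1 hz2 using hz
  have hzk : Filter.Tendsto z Filter.atTop Filter.atTop :=
    Filter.tendsto_atTop_mono (fun k => (le_max_left _ _).trans (hz1 k).le)
      tendsto_natCast_atTop_atTop
  have hinv : Filter.Tendsto (fun k => (z k)⁻¹) Filter.atTop (nhds 0) :=
    tendsto_inv_atTop_zero.comp hzk
  -- The points are the combinations `(1 - α/z) y + (α/z)(v + z d)`, which lie in the upper image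
  -- and tend to `y + α d`. Requiring `z > α + 1` makes the coefficients admissible.
  have hlim : Filter.Tendsto (fun k => (y + α • d) + (z k)⁻¹ • (α • (v - y))) Filter.atTop
      (nhds (y + α • d)) := by
    simpa using (tendsto_const_nhds (x := y + α • d)).add (hinv.smul_const (α • (v - y)))
  refine isClosed_upperImage.mem_of_tendsto hlim (Filter.Eventually.of_forall fun k => ?_)
  have hzα : α + 1 < z k := (le_max_right _ _).trans_lt (hz1 k)
  have hpos : 0 < z k := by linarith
  have := hP.convex_upperImage hy (hz2 k) (a := 1 - α / z k) (b := α / z k)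
    (by rw [sub_nonneg, div_le_one hpos]; linarith) (by positivity) (by ring)
  convert this using 1
  ext i
  simp only [Pi.add_apply, Pi.smul_apply, Pi.sub_apply, smul_eq_mul]
  field_simp
  ring

/-- Strong duality under a Slater condition: an optimal solution `w` of the Lagrangian dual is a
weight for which the primal optimal `x` solves the weighted sum problem. -/
lemma Assumption.P1Optimal_of_P2Optimal (hP : P.Assumption) {v d w k : Fin (m + 1) → ℝ}
    {x x₀ : Fin n → ℝ} {z : ℝ} (hx₀ : x₀ ∈ P.X)
    (hk : k ∈ interior (P.C : Set (Fin (m + 1) → ℝ))) (hv : v = P.Γ x₀ + k)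
    (h1 : P.P2Optimal v d x z) (h2 : P.D2Optimal v d w) : P.P1Optimal w x := by
  set A := P.Γ '' P.X + (P.C : Set (Fin (m + 1) → ℝ)) with hA
  have hvint : v ∈ interior A := by
    have hsub : {P.Γ x₀} + interior (P.C : Set (Fin (m + 1) → ℝ)) ⊆ interior A :=
      interior_maximal (add_subset_add (singleton_subset_iff.2 ⟨x₀, hx₀, rfl⟩) interior_subset)
        isOpen_interior.add_left
    exact hsub ⟨_, rfl, k, hk, hv.symm⟩
  -- Otherwise `z` could be increased.
  have hnot : v + z • d ∉ interior A := by
    intro hmem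
    have hcont : Continuous fun η : ℝ => v + (z + η) • d := by fun_prop
    have htend := (hcont.tendsto 0).mono_left (nhdsWithin_le_nhds (s := Ioi 0))
    simp only [add_zero] at htend
    obtain ⟨η, hη, hpos⟩ :=
      ((htend.eventually (mem_interior_iff_mem_nhds.1 hmem)).and self_mem_nhdsWithin).exists
    obtain ⟨_, ⟨x', hx', rfl⟩, l, hl, he⟩ := hη
    have := h1.2 x' (z + η) ⟨hx', by rw [← he]; simpa using hl⟩
    have hpos : 0 < η := hpos
    linarith
  obtain ⟨u, hu0, hu⟩ :=
    exists_dotProduct_le_of_notMem_interior hP.convex_image_add_cone ⟨v, hvint⟩ hnot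
  have huC : u ∈ dualCone (P.C : Set (Fin (m + 1) → ℝ)) := fun a ha =>
    nonneg_of_forall_lt_mul (γ := u ⬝ᵥ (v + z • d) - 1) (b := u ⬝ᵥ P.Γ x₀) fun l hl => by
      have := hu (P.Γ x₀ + l • a) ⟨_, ⟨x₀, hx₀, rfl⟩, _, P.C.smul_mem hl ha, rfl⟩
      rw [dotProduct_add _ (P.Γ x₀), dotProduct_smul, smul_eq_mul] at this
      linarith
  have hux : ∀ x' ∈ P.X, u ⬝ᵥ v + z * (u ⬝ᵥ d) ≤ u ⬝ᵥ P.Γ x' := fun x' hx' => by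
    have := hu (P.Γ x') ⟨_, ⟨x', hx', rfl⟩, 0, P.C.zero_mem, add_zero _⟩
    rwa [dotProduct_add, dotProduct_smul, smul_eq_mul] at this
  have hz : 0 ≤ z := h1.2 x₀ 0 ⟨hx₀, by rw [hv]; simpa using interior_subset hk⟩
  -- Slater condition: comparison with `Γ(x₀) = v - k` gives `z uᵀd ≤ -uᵀk < 0`, and `z ≥ 0`. So `u`
  -- can be scaled to be dual feasible.
  have hud : u ⬝ᵥ d < 0 := by
    have h3 := hux x₀ hx₀
    have h4 := dotProduct_pos_of_mem_interior huC hu0 hk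
    rw [hv, dotProduct_add] at h3
    by_contra! hcon
    nlinarith [mul_nonneg hz hcon]
  set κ := -(u ⬝ᵥ d) with hκ
  have hκpos : 0 < κ := by linarith
  have hfeas : P.D2Feasible d (κ⁻¹ • u) := by
    refine ⟨?_, fun a ha => ?_⟩
    · rw [smul_dotProduct, smul_eq_mul, show u ⬝ᵥ d = -κ by rw [hκ, neg_neg], mul_neg,
        inv_mul_cancel₀ hκpos.ne']
    · rw [smul_dotProduct]
      exact mul_nonneg (inv_nonneg.2 hκpos.le) (huC a ha)
  have hobj : P.D2Objective v (κ⁻¹ • u) ≤ (z : EReal) := by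
    have hsup : (⨆ x ∈ P.X, ((-((κ⁻¹ • u) ⬝ᵥ P.Γ x) : ℝ) : EReal)) ≤
        ((z - (κ⁻¹ • u) ⬝ᵥ v : ℝ) : EReal) := by
      refine iSup₂_le fun x' hx' => EReal.coe_le_coe_iff.2 ?_
      have h3 := mul_le_mul_of_nonneg_left (hux x' hx') (inv_nonneg.2 hκpos.le)
      have h4 := hfeas.1
      simp only [smul_dotProduct, smul_eq_mul] at h4 ⊢
      have h5 : κ⁻¹ * (z * (u ⬝ᵥ d)) = -z := by
        rw [mul_left_comm, h4]; ring
      rw [mul_add, h5] at h3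
      linarith
    calc P.D2Objective v (κ⁻¹ • u) ≤ ((z - (κ⁻¹ • u) ⬝ᵥ v : ℝ) : EReal) +
          (((κ⁻¹ • u) ⬝ᵥ v : ℝ) : EReal) := add_le_add_left hsup _
      _ = (z : EReal) := by rw [← EReal.coe_add, sub_add_cancel]
  have hle : P.D2Objective v w ≤ (z : EReal) := (h2.2 _ hfeas).trans hobj
  refine ⟨h1.1.1, fun x' hx' => ?_⟩
  have h3 : -(w ⬝ᵥ P.Γ x') + w ⬝ᵥ v ≤ z := by
    rw [← EReal.coe_le_coe_iff, EReal.coe_add]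
    refine le_trans (add_le_add_left ?_ _) hle
    exact le_iSup₂ (f := fun x (_ : x ∈ P.X) => ((-(w ⬝ᵥ P.Γ x) : ℝ) : EReal)) x' hx'
  -- Feasibility of `(x, z)` gives `wᵀΓ(x) ≤ wᵀv - z`, while the dual value being at most `z` gives
  -- `wᵀv - z ≤ wᵀΓ(x')`.
  have h4 := h2.1.2 _ h1.1.2
  rw [dotProduct_sub, dotProduct_add, dotProduct_smul, h2.1.1, smul_eq_mul] at h4
  linarith

end CVOP

/-! ### Invariants of loops -/

section Loops

variable {α σ : Type} {body : α → σ → σ → Prop}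

lemma RunList.invariant {I : σ → Prop} {l : List α} {s s' : σ} (h : RunList body l s s')
    (hI : ∀ a ∈ l, ∀ s s', I s → body a s s' → I s') (hs : I s) : I s' := by
  induction h with
  | nil => exact hs
  | cons hb _ ih =>
    exact ih (fun a ha => hI a (List.mem_cons_of_mem _ ha)) (hI _ List.mem_cons_self _ _ hs hb)

lemma RunList.forall_mem {Q : α → σ → Prop} {l : List α} {s s' : σ} (h : RunList body l s s')
    (hnew : ∀ a s s', body a s s' → Q a s')
    (hstable : ∀ a b s s', Q b s → body a s s' → Q b s') : ∀ a ∈ l, Q a s' := by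
  induction h with
  | nil => simp
  | cons hb hr ih =>
    intro b hmem
    rcases List.mem_cons.1 hmem with rfl | hmem
    · exact hr.invariant (I := Q b) (fun a _ s s' => hstable a b s s') (hnew _ _ _ hb)
    · exact ih b hmem

lemma ForEach.invariant {I : σ → Prop} {A : Set α} {s s' : σ} (h : ForEach A body s s')
    (hI : ∀ a ∈ A, ∀ s s', I s → body a s s' → I s') (hs : I s) : I s' := by
  obtain ⟨l, -, hl, hr⟩ := h
  exact hr.invariant (fun a ha => hI a ((hl a).1 ha)) hs

lemma ForEach.forall_mem {Q : α → σ → Prop} {A : Set α} {s s' : σ} (h : ForEach A body s s')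
    (hnew : ∀ a s s', body a s s' → Q a s')
    (hstable : ∀ a b s s', Q b s → body a s s' → Q b s') : ∀ a ∈ A, Q a s' := by
  obtain ⟨l, -, hl, hr⟩ := h
  exact fun a ha => hr.forall_mem hnew hstable a ((hl a).2 ha)

/-- Applied to the vertex loop, termination itself shows that `D` has finitely many vertices. -/
lemma ForEach.finite {A : Set α} {s s' : σ} (h : ForEach A body s s') : A.Finite := by
  obtain ⟨l, -, hl, -⟩ := h
  exact (List.finite_toSet l).subset fun a ha => (hl a).2 ha

lemma While.invariant {cond : σ → Prop} {body : σ → σ → Prop} {I : σ → Prop} {s s' : σ}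
    (h : While cond body s s') (hI : ∀ s s', I s → body s s' → I s') (hs : I s) : I s' := by
  obtain ⟨h, -⟩ := h
  induction h with
  | refl => exact hs
  | tail _ hb ih => exact hI _ _ ih hb.2

end Loops

/-! ### The initialization algorithm -/

section Init

variable {n m : ℕ} {P : CVOP n m} {p : Params m} {δ : ℝ}

/-- The normalized dual point `Tᵀ (w / cᵀw)`. -/
noncomputable def dualPoint (p : Params m) (w : Fin (m + 1) → ℝ) : Fin (m + 1) → ℝ :=
  p.Tᵀ *ᵥ ((p.c ⬝ᵥ w)⁻¹ • w)

/-- `F` is the set of pairs `(x, w)` with which the state `s` has been cut. -/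
structure InitInvariant (P : CVOP n m) (p : Params m) (δ : ℝ)
    (F : Set ((Fin n → ℝ) × (Fin (m + 1) → ℝ))) (s : InitState n m) : Prop where
  finite : F.Finite
  optimal : ∀ f ∈ F, P.P1Optimal f.2 f.1
  mem_dual : ∀ f ∈ F, f.2 ∈ dualCone (P.C : Set (Fin (m + 1) → ℝ))
  ne_zero : ∀ f ∈ F, f.2 ≠ 0
  P0_eq : s.P0 = {y | ∀ f ∈ F, 0 ≤ f.2 ⬝ᵥ (y - P.Γ f.1)}
  Xbar_eq : s.Xbar = Prod.fst '' F
  Tbar_eq : s.Tbar = (fun f => dualPoint p f.2) '' F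
  YIn_recession : s.YIn ⊆ recessionCone P.upperImage
  YIn_norm : ∀ r ∈ s.YIn, l1norm r = 1
  Chat_near : ∀ d ∈ s.Chat, ∃ r ∈ s.YIn, l1norm (d - r) ≤ δ

lemma Params.Admissible.C_subset (hp : p.Admissible P) :
    (p.R : Set (Fin (m + 1) → ℝ)) ⊆ (P.C : Set (Fin (m + 1) → ℝ)) :=
  hp.R_generates ▸ subset_cone _

lemma Params.Admissible.sum_mem_interior (hp : p.Admissible P) :
    ∑ d ∈ p.R, d ∈ interior (P.C : Set (Fin (m + 1) → ℝ)) := by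
  rw [← hp.R_generates]
  exact sum_mem_interior_cone ⟨p.c, hp.R_generates.symm ▸ hp.c_mem⟩

lemma initInvariant_start (hp : p.Admissible P) :
    InitInvariant P p δ ∅ (initStart p : InitState n m) where
  finite := finite_empty
  optimal := by simp
  mem_dual := by simp
  ne_zero := by simp
  P0_eq := by simp [initStart]
  Xbar_eq := by simp [initStart]
  Tbar_eq := by simp [initStart]
  YIn_recession := hp.C_subset.trans CVOP.cone_subset_recessionCone_upperImage
  YIn_norm := fun r hr => hp.R_norm r hr
  Chat_near := by simp [initStart]

variable {F : Set ((Fin n → ℝ) × (Fin (m + 1) → ℝ))} {s : InitState n m}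

lemma InitInvariant.cut (h : InitInvariant P p δ F s) {x : Fin n → ℝ} {w : Fin (m + 1) → ℝ}
    (hx : P.P1Optimal w x) (hw : w ∈ dualCone (P.C : Set (Fin (m + 1) → ℝ))) (h0 : w ≠ 0) :
    InitInvariant P p δ (insert (x, w) F) (s.cut P p x w) where
  finite := h.finite.insert _
  optimal := forall_mem_insert.2 ⟨hx, h.optimal⟩
  mem_dual := forall_mem_insert.2 ⟨hw, h.mem_dual⟩
  ne_zero := forall_mem_insert.2 ⟨h0, h.ne_zero⟩
  P0_eq := by
    ext y
    simp only [InitState.cut, h.P0_eq, mem_inter_iff, mem_ofPred_eq, forall_mem_insert]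
    exact and_comm
  Xbar_eq := by rw [image_insert_eq]; simp [InitState.cut, h.Xbar_eq]
  Tbar_eq := by rw [image_insert_eq]; simp [InitState.cut, h.Tbar_eq, dualPoint]
  YIn_recession := h.YIn_recession
  YIn_norm := h.YIn_norm
  Chat_near := h.Chat_near

lemma InitInvariant.insert_YIn (h : InitInvariant P p δ F s) {d : Fin (m + 1) → ℝ}
    (hd : d ∈ recessionCone P.upperImage) (h1 : l1norm d = 1) :
    InitInvariant P p δ F { s with YIn := insert d s.YIn } :=
  { h with
    YIn_recession := insert_subset hd h.YIn_recession
    YIn_norm := forall_mem_insert.2 ⟨h1, h.YIn_norm⟩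
    Chat_near := fun d hd => (h.Chat_near d hd).imp fun _ hr => ⟨mem_insert_of_mem _ hr.1, hr.2⟩ }

/-- All of `Γ(X)` satisfies the cuts, so `P0` is nonempty and its recession cone is obtained by
homogenizing the inequalities. -/
lemma InitInvariant.recessionCone_P0 (hP : P.Assumption) (h : InitInvariant P p δ F s) :
    recessionCone s.P0 = dualCone (Prod.snd '' F) := by
  obtain ⟨x₀, hx₀⟩ := hP.X_nonempty
  ext d
  constructor
  · rintro hd _ ⟨f, hf, rfl⟩
    rw [dotProduct_comm]
    have hmem : P.Γ x₀ ∈ s.P0 := by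
      rw [h.P0_eq]
      intro g hg
      rw [dotProduct_sub, sub_nonneg]
      exact (h.optimal g hg).2 x₀ hx₀
    refine dotProduct_nonneg_of_mem_recessionCone ⟨_, hmem⟩ (γ := f.2 ⬝ᵥ P.Γ f.1) ?_ hd
    intro y hy
    rw [h.P0_eq] at hy
    have := hy f hf
    rwa [dotProduct_sub, sub_nonneg] at this
  · intro hd y hy α hα
    rw [h.P0_eq] at hy ⊢
    intro f hf
    have h1 := hy f hf
    have h2 := hd f.2 ⟨f, hf, rfl⟩
    rw [dotProduct_comm] at h2
    rw [add_sub_right_comm, dotProduct_add, dotProduct_smul]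
    exact add_nonneg h1 (mul_nonneg hα h2)

/-- What the initialization algorithm guarantees about its output. -/
structure InitGuarantee (P : CVOP n m) (p : Params m) (δ : ℝ)
    (F : Set ((Fin n → ℝ) × (Fin (m + 1) → ℝ))) (s : InitState n m) : Prop where
  finite : F.Finite
  optimal : ∀ f ∈ F, P.P1Optimal f.2 f.1
  ne_zero : ∀ f ∈ F, f.2 ≠ 0
  Xbar_eq : s.Xbar = Prod.fst '' F
  Tbar_eq : s.Tbar = (fun f => dualPoint p f.2) '' F
  mem_dual_YOut : ∀ f ∈ F, f.2 ∈ dualCone (cone s.YOut)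
  finite_YOut : s.YOut.Finite
  outer : P.IsOuterApprox δ s.YOut
  isClosed_cone : IsClosed (cone s.YOut)
  recession_univ : F = ∅ → recessionCone P.upperImage = univ

lemma isOuterApprox_of_forall_exists {Y : Set (Fin (m + 1) → ℝ)}
    (h1 : recessionCone P.upperImage ⊆ cone Y)
    (h2 : ∀ y ∈ cone Y ∩ l1Ball (m + 1),
      ∃ r ∈ recessionCone P.upperImage ∩ l1Ball (m + 1), l1norm (y - r) ≤ δ) :
    P.IsOuterApprox δ Y := by
  refine ⟨h1, Metric.hausdorffEDist_le_of_mem_edist ?_ ?_⟩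
  · rintro _ ⟨y, hy, rfl⟩
    exact ⟨_, ⟨y, ⟨h1 hy.1, hy.2⟩, rfl⟩, by simp⟩
  · rintro _ ⟨y, hy, rfl⟩
    obtain ⟨r, hr, hle⟩ := h2 y hy
    refine ⟨_, ⟨r, hr, rfl⟩, ?_⟩
    rw [edist_toLp_one]
    exact ENNReal.ofReal_le_ofReal hle

/-- The guarantee holds once each outer direction is an inner direction or close to one. -/
lemma InitInvariant.guarantee (hP : P.Assumption) (hp : p.Admissible P) (hδ : 0 ≤ δ)
    (h : InitInvariant P p δ F s) (hY : s.YOut = outerDirections s.P0) (hterm : ¬ initCond s)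
    (hR : -(p.R : Set (Fin (m + 1) → ℝ)) ⊆ s.YIn ∨ s.Xbar.Nonempty) :
    InitGuarantee P p δ F s := by
  set W := Prod.snd '' F with hW
  have hWfin : W.Finite := h.finite.image _
  have hYW : s.YOut = (dualCone W ∩ l1Ball (m + 1)).extremePoints ℝ \ {0} := by
    rw [hY, outerDirections, h.recessionCone_P0 hP]
  have hcone : cone s.YOut = dualCone W := by
    rw [hYW, cone_extremePoints_dualCone_inter_l1Ball hWfin]
  have hYsub : s.YOut ⊆ s.YIn ∪ s.Chat := by
    rwa [initCond, not_nonempty_iff_eq_empty, sdiff_eq_empty] at hterm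
  have hsub : recessionCone P.upperImage ⊆ cone s.YOut := by
    rw [hcone]
    rintro d hd _ ⟨f, hf, rfl⟩
    rw [dotProduct_comm]
    exact (h.optimal f hf).dotProduct_nonneg (h.mem_dual f hf) hd
  have hin : ∀ r ∈ s.YIn, r ∈ recessionCone P.upperImage ∩ l1Ball (m + 1) := fun r hr =>
    ⟨h.YIn_recession hr, (h.YIn_norm r hr).le⟩
  -- The points within `δ` of a convex set form a convex set, so nearness need only be checked at
  -- vertices.
  have hnear : Convex ℝ {y : Fin (m + 1) → ℝ |
      ∃ r ∈ recessionCone P.upperImage ∩ l1Ball (m + 1), l1norm (y - r) ≤ δ} := by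
    rintro y ⟨r, hr, hyr⟩ z ⟨t, ht, hzt⟩ a b ha hb hab
    refine ⟨a • r + b • t, (convex_recessionCone.inter convex_l1Ball) hr ht ha hb hab, ?_⟩
    have : a • y + b • z - (a • r + b • t) = a • (y - r) + b • (z - t) := by
      simp only [smul_sub]; abel
    rw [this]
    calc l1norm (a • (y - r) + b • (z - t)) ≤ a * l1norm (y - r) + b * l1norm (z - t) :=
          convexOn_l1norm.2 (mem_univ _) (mem_univ _) ha hb hab
      _ ≤ a * δ + b * δ := by gcongr
      _ = δ := by rw [← add_mul, hab, one_mul]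
  refine ⟨h.finite, h.optimal, h.ne_zero, h.Xbar_eq, h.Tbar_eq, ?_, ?_,
    isOuterApprox_of_forall_exists hsub ?_, hcone ▸ isClosed_dualCone W, ?_⟩
  · intro f hf a ha
    rw [hcone] at ha
    rw [dotProduct_comm]
    exact ha f.2 ⟨f, hf, rfl⟩
  · rw [hYW]
    exact (finite_extremePoints_dualCone_inter_l1Ball hWfin).sdiff
  · rw [hcone, ← convexHull_extremePoints_dualCone_inter_l1Ball hWfin]
    refine fun y hy => convexHull_min (fun y hy => ?_) hnear hy
    by_cases h0 : y = 0
    · refine ⟨0, ⟨zero_mem_recessionCone, ?_⟩, ?_⟩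
      · simp [l1Ball, l1norm_zero]
      · simpa [h0, l1norm_zero] using hδ
    · rcases hYsub (show y ∈ s.YOut from hYW ▸ ⟨hy, h0⟩) with hyin | hych
      · exact ⟨y, hin y hyin, by simpa [l1norm_zero] using hδ⟩
      · obtain ⟨r, hr, hle⟩ := h.Chat_near y hych
        exact ⟨r, hin r hr, hle⟩
  -- Without cuts, `C` and `-C` both consist of recession directions; then `-c + int C` is a
  -- neighbourhood of `0` among them.
  · rintro rfl
    rw [h.Xbar_eq, image_empty] at hR
    have hR := hR.resolve_right not_nonempty_empty
    have hneg : ∀ a ∈ (P.C : Set (Fin (m + 1) → ℝ)), -a ∈ recessionCone P.upperImage := by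
      rw [← hp.R_generates]
      refine cone_subset (A := {a | -a ∈ recessionCone P.upperImage}) ?_ ?_ ?_ ?_
      · simpa using zero_mem_recessionCone
      · intro a ha b hb
        change -(a + b) ∈ recessionCone P.upperImage
        rw [neg_add]
        exact add_mem_recessionCone ha hb
      · intro k hk a ha
        change -(k • a) ∈ recessionCone P.upperImage
        rw [← smul_neg]
        exact smul_mem_recessionCone hk ha
      · exact fun a ha => h.YIn_recession (hR (by simpa using ha))
    have hc0 : (0 : Fin (m + 1) → ℝ) ∈ interior (recessionCone P.upperImage) := by
      have hsub : {-p.c} + interior (P.C : Set (Fin (m + 1) → ℝ)) ⊆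
          interior (recessionCone P.upperImage) := by
        refine interior_maximal ?_ isOpen_interior.add_left
        rintro _ ⟨_, rfl, k, hk, rfl⟩
        exact add_mem_recessionCone (hneg _ (interior_subset hp.c_mem))
          (CVOP.cone_subset_recessionCone_upperImage (interior_subset hk))
      exact hsub ⟨_, rfl, p.c, hp.c_mem, neg_add_cancel _⟩
    refine eq_univ_of_forall fun y => ?_
    have htend : Filter.Tendsto (fun η : ℝ => η • y) (nhdsWithin 0 (Ioi 0)) (nhds 0) := by
      have hcont : Continuous fun η : ℝ => η • y := by fun_prop
      simpa using (hcont.tendsto 0).mono_left nhdsWithin_le_nhds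
    obtain ⟨η, hη, hpos⟩ :=
      ((htend.eventually (mem_interior_iff_mem_nhds.1 hc0)).and self_mem_nhdsWithin).exists
    have hpos : 0 < η := hpos
    have := smul_mem_recessionCone (inv_nonneg.2 hpos.le) hη
    rwa [inv_smul_smul₀ hpos.ne'] at this

lemma mem_C_of_forall_Rstar (hP : P.Assumption) (hp : p.Admissible P) {d : Fin (m + 1) → ℝ}
    (hd : ∀ z ∈ p.Rstar, 0 ≤ z ⬝ᵥ d) : d ∈ P.C := by
  by_contra hnot
  obtain ⟨w, hw, hlt⟩ := exists_mem_dualCone_neg hP.C_closed hnot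
  rw [← hp.Rstar_generates] at hw
  have h1 : d ∈ dualCone (cone (p.Rstar : Set (Fin (m + 1) → ℝ))) :=
    mem_dualCone_cone fun z hz => by rw [dotProduct_comm]; exact hd z hz
  have := h1 w hw
  rw [dotProduct_comm] at this
  linarith

/-- The guarantee in the case that all weighted sum problems for `Rstar` are bounded. -/
lemma InitInvariant.guarantee_of_bounded (hP : P.Assumption) (hp : p.Admissible P) (hδ : 0 ≤ δ)
    (h : InitInvariant P p δ F s) (hb : ∀ z ∈ p.Rstar, P.P1Bounded z ∧ s.Xbar.Nonempty) :
    InitGuarantee P p δ F { s with YOut := p.R } := by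
  have hsub : recessionCone P.upperImage ⊆ cone (p.R : Set (Fin (m + 1) → ℝ)) := by
    intro d hd
    rw [hp.R_generates]
    refine mem_C_of_forall_Rstar hP hp fun z hz => ?_
    obtain ⟨γ, hγ⟩ := (hb z hz).1
    refine dotProduct_nonneg_of_mem_recessionCone hP.upperImage_nonempty
      (CVOP.le_dotProduct_of_mem_upperImage (hp.Rstar_generates ▸ subset_cone _ hz)
        fun x hx => hγ ⟨x, hx, rfl⟩) hd
  refine ⟨h.finite, h.optimal, h.ne_zero, h.Xbar_eq, h.Tbar_eq, ?_, p.R.finite_toSet,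
    isOuterApprox_of_forall_exists hsub fun y hy => ⟨y, ⟨?_, hy.2⟩, ?_⟩, ?_, ?_⟩
  · simpa only [hp.R_generates] using h.mem_dual
  · have := hy.1
    rw [hp.R_generates] at this
    exact CVOP.cone_subset_recessionCone_upperImage this
  · simpa [l1norm_zero] using hδ
  · simpa only [hp.R_generates] using hP.C_closed
  · rintro rfl
    -- No cut means that `Rstar` is empty, which would force `C` to be the whole space.
    refine absurd (eq_univ_of_forall fun d => ?_) hP.C_ne_univ
    refine mem_C_of_forall_Rstar hP hp fun z hz => ?_
    have := (hb z hz).2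
    rw [h.Xbar_eq, image_empty] at this
    exact absurd this not_nonempty_empty

lemma D2Feasible_ne_zero {d w : Fin (m + 1) → ℝ} (h : P.D2Feasible d w) : w ≠ 0 := by
  rintro rfl
  simpa using h.1

/-- The existence of a set `F` of cuts is carried through all three loops. The lineality check adds
the alternative that either all of `-R` are recession directions or some cut was made, which is what
controls the case `F = ∅`. -/
lemma InitRun.guarantee (hP : P.Assumption) (hp : p.Admissible P) (hδ : 0 ≤ δ)
    {out : InitState n m} (h : InitRun P p δ out) : ∃ F, InitGuarantee P p δ F out := by
  obtain ⟨x₀, hx₀, s₁, hfor, hcase⟩ := h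
  have hσ := hp.sum_mem_interior
  have hs₁ : ∃ F, InitInvariant P p δ F s₁ := by
    refine hfor.invariant (I := fun s => ∃ F, InitInvariant P p δ F s) ?_
      ⟨_, initInvariant_start hp⟩
    rintro z hz s s' ⟨F, hF⟩ (⟨-, rfl⟩ | ⟨x, hx, rfl⟩)
    · exact ⟨F, { hF with }⟩
    · refine ⟨_, hF.cut hx (hp.Rstar_generates ▸ subset_cone _ hz) ?_⟩
      rintro rfl
      simpa using hp.Rstar_norm 0 hz
  have hb := hfor.forall_mem
    (Q := fun z s => s.b = true → P.P1Bounded z ∧ s.Xbar.Nonempty)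
    (by
      rintro z s s' (⟨-, rfl⟩ | ⟨x, hx, rfl⟩) hbt
      · simp at hbt
      · refine ⟨⟨z ⬝ᵥ P.Γ x, ?_⟩, ⟨x, mem_insert _ _⟩⟩
        rintro _ ⟨x', hx', rfl⟩
        exact hx.2 x' hx')
    (by
      rintro z z' s s' hQ (⟨-, rfl⟩ | ⟨x, hx, rfl⟩) hbt
      · simp at hbt
      · exact ⟨(hQ hbt).1, (hQ hbt).2.mono (subset_insert _ _)⟩)
  obtain ⟨F₁, hF₁⟩ := hs₁
  rcases hcase with ⟨hbt, rfl⟩ | ⟨-, s₂, hfor₂, hwhile⟩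
  · exact ⟨F₁, hF₁.guarantee_of_bounded hP hp hδ fun z hz => hb z hz hbt⟩
  · have hs₂ : ∃ F, InitInvariant P p δ F s₂ := by
      refine hfor₂.invariant (I := fun s => ∃ F, InitInvariant P p δ F s) ?_ ⟨_, hF₁⟩
      rintro d hd s s' ⟨F, hF⟩ (⟨hunb, rfl⟩ | ⟨x, z, w, h1, h2, rfl⟩)
      · refine ⟨F, hF.insert_YIn (hP.mem_recessionCone_of_P2Unbounded hunb) ?_⟩
        rw [← l1norm_neg]
        exact hp.R_norm _ hd
      · exact ⟨_, hF.cut (hP.P1Optimal_of_P2Optimal hx₀ hσ rfl h1 h2) h2.1.2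
          (D2Feasible_ne_zero h2.1)⟩
    have hR := hfor₂.forall_mem (Q := fun d s => d ∈ s.YIn ∨ s.Xbar.Nonempty)
      (by
        rintro d s s' (⟨-, rfl⟩ | ⟨x, z, w, -, -, rfl⟩)
        · exact Or.inl (mem_insert _ _)
        · exact Or.inr ⟨x, mem_insert _ _⟩)
      (by
        rintro d d' s s' hQ (⟨-, rfl⟩ | ⟨x, z, w, -, -, rfl⟩)
        · exact hQ.imp_left fun h => mem_insert_of_mem _ h
        · exact Or.inr ⟨x, mem_insert _ _⟩)
    obtain ⟨F₂, hF₂⟩ := hs₂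
    obtain ⟨⟨F, hF⟩, hY, hR'⟩ := hwhile.invariant (I := fun s => (∃ F, InitInvariant P p δ F s) ∧
        s.YOut = outerDirections s.P0 ∧
        (-(p.R : Set (Fin (m + 1) → ℝ)) ⊆ s.YIn ∨ s.Xbar.Nonempty))
      (by
        rintro s s' ⟨⟨F, hF⟩, hY, hR⟩ ⟨d, hd, r, hr, -, ⟨hle, rfl⟩ |
          ⟨-, lam, -, -, e, -, he0, ⟨hunb, rfl⟩ | ⟨x, z, w, h1, h2, rfl⟩⟩⟩
        · exact ⟨⟨F, { hF with Chat_near := forall_mem_insert.2 ⟨⟨r, hr, hle⟩, hF.Chat_near⟩ }⟩,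
            hY, hR⟩
        · have hpos := l1norm_pos he0
          refine ⟨⟨F, hF.insert_YIn (smul_mem_recessionCone (inv_nonneg.2 hpos.le)
            (hP.mem_recessionCone_of_P2Unbounded hunb)) ?_⟩, hY,
            hR.imp_left fun h => h.trans (subset_insert _ _)⟩
          rw [l1norm_smul, abs_of_pos (inv_pos.2 hpos), inv_mul_cancel₀ hpos.ne']
        · have hcut := hF.cut (hP.P1Optimal_of_P2Optimal hx₀ hσ rfl h1 h2) h2.1.2
            (D2Feasible_ne_zero h2.1)
          exact ⟨⟨_, { hcut with }⟩, rfl, Or.inr ⟨x, mem_insert _ _⟩⟩)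
      ⟨⟨F₂, { hF₂ with }⟩, rfl, by
        by_cases hX : s₂.Xbar.Nonempty
        · exact Or.inr hX
        · exact Or.inl fun d hd => (hR d hd).resolve_right hX⟩
    exact ⟨F, hF.guarantee hP hp hδ hY hwhile.2 hR'⟩

end Init

variable {n m : ℕ} {P : CVOP n m} {p : Params m} {ε δ : ℝ}

/-! ### The weights `w(t)` and the dual objective -/

section Weights

variable {T : Matrix (Fin (m + 1)) (Fin (m + 1)) ℝ}

lemma wOf_update (T : Matrix (Fin (m + 1)) (Fin (m + 1)) ℝ) (t : Fin (m + 1) → ℝ) (s : ℝ) :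
    wOf T (Function.update t (Fin.last m) s) = wOf T t := by
  simp [wOf]

lemma wOf_congr {t u : Fin (m + 1) → ℝ}
    (h : (Fin.init t : Fin m → ℝ) = Fin.init u) : wOf T t = wOf T u := by
  have : u = Function.update t (Fin.last m) (u (Fin.last m)) := by
    ext i
    refine Fin.lastCases ?_ (fun j => ?_) i
    · simp
    · rw [Function.update_of_ne (Fin.castSucc_lt_last j).ne]
      exact (congrFun h j).symm
  rw [this, wOf_update]

lemma wOf_combo (T : Matrix (Fin (m + 1)) (Fin (m + 1)) ℝ) (t u : Fin (m + 1) → ℝ) {a b : ℝ}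
    (hab : a + b = 1) : wOf T (a • t + b • u) = a • wOf T t + b • wOf T u := by
  unfold wOf
  rw [← Matrix.smul_vecMul, ← Matrix.smul_vecMul, ← Matrix.add_vecMul]
  congr 1
  ext i
  by_cases hi : i = Fin.last m
  · subst hi; simp [hab]
  · simp [hi]

lemma continuous_wOf (T : Matrix (Fin (m + 1)) (Fin (m + 1)) ℝ) : Continuous (wOf T) := by
  unfold wOf
  exact Continuous.matrix_vecMul (continuous_id.update _ continuous_const) continuous_const

lemma continuous_wOf_dotProduct (T : Matrix (Fin (m + 1)) (Fin (m + 1)) ℝ)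
    (y : Fin (m + 1) → ℝ) : Continuous fun t => wOf T t ⬝ᵥ y :=
  (continuous_wOf T).dotProduct continuous_const

lemma Params.Admissible.transpose_mulVec_last (hp : p.Admissible P) (w : Fin (m + 1) → ℝ) :
    (p.Tᵀ *ᵥ w) (Fin.last m) = w ⬝ᵥ p.c := by
  rw [dotProduct_comm, ← show (fun i => p.T i (Fin.last m)) = p.c from funext hp.T_last_column]
  rfl

lemma Params.Admissible.transpose_mulVec_wOf (hp : p.Admissible P) (t : Fin (m + 1) → ℝ) :
    p.Tᵀ *ᵥ wOf p.T t = Function.update t (Fin.last m) 1 := by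
  rw [Matrix.mulVec_transpose, wOf, Matrix.vecMul_vecMul, Matrix.nonsing_inv_mul _ hp.T_nonsingular,
    Matrix.vecMul_one]

lemma Params.Admissible.wOf_dotProduct_c (hp : p.Admissible P) (t : Fin (m + 1) → ℝ) :
    wOf p.T t ⬝ᵥ p.c = 1 := by
  rw [← hp.transpose_mulVec_last, hp.transpose_mulVec_wOf]
  simp

lemma Params.Admissible.wOf_ne_zero (hp : p.Admissible P) (t : Fin (m + 1) → ℝ) :
    wOf p.T t ≠ 0 := fun h => by
  have := hp.wOf_dotProduct_c t
  rw [h, zero_dotProduct] at this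
  exact zero_ne_one this

lemma Params.Admissible.wOf_transpose_mulVec (hp : p.Admissible P) {w : Fin (m + 1) → ℝ}
    (hw : w ⬝ᵥ p.c = 1) :
    wOf p.T (p.Tᵀ *ᵥ w) = w := by
  have h : Function.update (p.Tᵀ *ᵥ w) (Fin.last m) 1 = p.Tᵀ *ᵥ w := by
    rw [← hw, ← hp.transpose_mulVec_last, Function.update_eq_self]
  rw [wOf, h, Matrix.mulVec_transpose, Matrix.vecMul_vecMul,
    Matrix.mul_nonsing_inv _ hp.T_nonsingular, Matrix.vecMul_one]

end Weights

lemma dualObjective_eq_of_P1Optimal {T : Matrix (Fin (m + 1)) (Fin (m + 1)) ℝ}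
    {t : Fin (m + 1) → ℝ} {x : Fin n → ℝ} (h : P.P1Optimal (wOf T t) x) :
    dualObjective P T t = (Fin.init t, ((wOf T t ⬝ᵥ P.Γ x : ℝ) : EReal)) := by
  refine Prod.ext rfl (le_antisymm (iInf₂_le x h.1) (le_iInf₂ fun x' hx' => ?_))
  exact EReal.coe_le_coe_iff.2 (h.2 x' hx')

/-- `D*(t)` reproduces the first `q-1` coordinates of `t` and depends on nothing else, so a
dominating image point would have the same last entry, which is finite. -/
lemma isDualMaximizer_of_P1Optimal {T : Matrix (Fin (m + 1)) (Fin (m + 1)) ℝ}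
    {A : Set (Fin (m + 1) → ℝ)} {t : Fin (m + 1) → ℝ} {x : Fin n → ℝ}
    (ht : wOf T t ∈ dualCone A) (h : P.P1Optimal (wOf T t) x) : IsDualMaximizer P T A t := by
  refine ⟨ht, ?_⟩
  rintro k hk ⟨t', -, he⟩
  have hinit : (Fin.init t' : Fin m → ℝ) = Fin.init t := congrArg Prod.fst he
  have hsame : dualObjective P T t' = dualObjective P T t := by
    unfold dualObjective
    rw [wOf_congr hinit, hinit]
  have h2 := congrArg Prod.snd (hsame.symm.trans he)
  rw [dualObjective_eq_of_P1Optimal h] at h2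
  have h3 : wOf T t ⬝ᵥ P.Γ x = wOf T t ⬝ᵥ P.Γ x + k := by
    rw [← EReal.coe_eq_coe_iff, EReal.coe_add]
    exact h2
  linarith

lemma P1Optimal_smul {w : Fin (m + 1) → ℝ} {x : Fin n → ℝ} {k : ℝ} (hk : 0 ≤ k)
    (h : P.P1Optimal w x) : P.P1Optimal (k • w) x :=
  ⟨h.1, fun x' hx' => by
    rw [smul_dotProduct, smul_dotProduct]
    exact mul_le_mul_of_nonneg_left (h.2 x' hx') hk⟩

/-! ### The main loop of the dual algorithm -/

/-- The invariant of the main loop, for the directions `Y` and points `X₀` found initially. -/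
structure DualInvariant (P : CVOP n m) (p : Params m) (Y : Set (Fin (m + 1) → ℝ))
    (X₀ : Set (Fin n → ℝ)) (s : DualState n m) : Prop where
  isClosed_D : IsClosed s.D
  mem_dual : ∀ t ∈ s.D, wOf p.T t ∈ dualCone (cone Y)
  last_le : ∀ t ∈ s.D, ∀ x ∈ X₀, t (Fin.last m) ≤ wOf p.T t ⬝ᵥ P.Γ x
  mem_D : ∀ t, wOf p.T t ∈ dualCone (cone Y) →
    (∀ x ∈ s.Xbar, t (Fin.last m) ≤ wOf p.T t ⬝ᵥ P.Γ x) → t ∈ s.D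
  finite_X : s.Xbar.Finite
  finite_T : s.Tbar.Finite
  subset_X : X₀ ⊆ s.Xbar
  X_optimal : ∀ x ∈ s.Xbar, ∃ w ∈ dualCone (cone Y), w ≠ 0 ∧ P.P1Optimal w x
  T_optimal : ∀ t ∈ s.Tbar, wOf p.T t ∈ dualCone (cone Y) ∧ ∃ x, P.P1Optimal (wOf p.T t) x

lemma InitGuarantee.interior_cone (hp : p.Admissible P)
    {F : Set ((Fin n → ℝ) × (Fin (m + 1) → ℝ))} {s₀ : InitState n m}
    (h : InitGuarantee P p δ F s₀) : p.c ∈ interior (cone s₀.YOut) :=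
  interior_mono (CVOP.cone_subset_recessionCone_upperImage.trans h.outer.1) hp.c_mem

lemma InitGuarantee.dualInvariant (hp : p.Admissible P)
    {F : Set ((Fin n → ℝ) × (Fin (m + 1) → ℝ))} {s₀ : InitState n m}
    (h : InitGuarantee P p δ F s₀) :
    DualInvariant P p s₀.YOut s₀.Xbar
      { D := initialD P p s₀, M := ∅, Xbar := s₀.Xbar, Tbar := s₀.Tbar } where
  isClosed_D := by
    refine ((isClosed_dualCone _).preimage (continuous_wOf p.T)).inter
      (isClosed_biInter fun x _ => isClosed_le continuous_const ?_)
    exact (continuous_wOf_dotProduct _ _).sub (continuous_apply _)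
  mem_dual := fun t ht => ht.1
  last_le := fun t ht x hx => sub_nonneg.1 (mem_iInter₂.1 ht.2 x hx)
  mem_D := fun t h1 h2 => ⟨h1, mem_iInter₂.2 fun x hx => sub_nonneg.2 (h2 x hx)⟩
  finite_X := by rw [h.Xbar_eq]; exact h.finite.image _
  finite_T := by rw [h.Tbar_eq]; exact h.finite.image _
  subset_X := Subset.rfl
  X_optimal := by
    rw [h.Xbar_eq]
    rintro _ ⟨f, hf, rfl⟩
    exact ⟨f.2, h.mem_dual_YOut f hf, h.ne_zero f hf, h.optimal f hf⟩
  T_optimal := by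
    rw [h.Tbar_eq]
    rintro _ ⟨f, hf, rfl⟩
    -- Positivity of `wᵀc` makes the normalization in the stored dual point legitimate.
    have hpos : 0 < f.2 ⬝ᵥ p.c := dotProduct_pos_of_mem_interior (h.mem_dual_YOut f hf)
      (h.ne_zero f hf) (h.interior_cone hp)
    have hw : wOf p.T (dualPoint p f.2) = (f.2 ⬝ᵥ p.c)⁻¹ • f.2 := by
      rw [dualPoint, dotProduct_comm p.c]
      refine hp.wOf_transpose_mulVec ?_
      rw [smul_dotProduct, smul_eq_mul, inv_mul_cancel₀ hpos.ne']
    rw [hw]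
    refine ⟨fun a ha => ?_, f.1, P1Optimal_smul (inv_nonneg.2 hpos.le) (h.optimal f hf)⟩
    rw [smul_dotProduct]
    exact mul_nonneg (inv_nonneg.2 hpos.le) (h.mem_dual_YOut f hf a ha)

section MainLoop

variable {Y : Set (Fin (m + 1) → ℝ)} {X₀ : Set (Fin n → ℝ)} {s s' : DualState n m}

/-- The vertex `v` has been processed without being cut off. -/
def VertexDone (P : CVOP n m) (p : Params m) (ε : ℝ) (v : Fin (m + 1) → ℝ)
    (s : DualState n m) : Prop :=
  ∃ x, P.P1Optimal (wOf p.T v) x ∧ v (Fin.last m) - wOf p.T v ⬝ᵥ P.Γ x ≤ ε ∧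
    p.Tᵀ *ᵥ wOf p.T v ∈ s.Tbar

lemma DualInvariant.insert (hp : p.Admissible P) (h : DualInvariant P p Y X₀ s)
    {v : Fin (m + 1) → ℝ} {x : Fin n → ℝ} (hv : wOf p.T v ∈ dualCone (cone Y))
    (hx : P.P1Optimal (wOf p.T v) x) {M : Set (Fin (m + 1) → ℝ)} :
    DualInvariant P p Y X₀ { s with
      Xbar := insert x s.Xbar
      Tbar := insert (p.Tᵀ *ᵥ wOf p.T v) s.Tbar
      M := M } where
  isClosed_D := h.isClosed_D
  mem_dual := h.mem_dual
  last_le := h.last_le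
  mem_D := fun t h1 h2 => h.mem_D t h1 (forall_mem_insert.1 h2).2
  finite_X := h.finite_X.insert _
  finite_T := h.finite_T.insert _
  subset_X := h.subset_X.trans (subset_insert _ _)
  X_optimal := forall_mem_insert.2 ⟨⟨_, hv, hp.wOf_ne_zero v, hx⟩, h.X_optimal⟩
  T_optimal := by
    refine forall_mem_insert.2 ⟨?_, h.T_optimal⟩
    rw [hp.wOf_transpose_mulVec (hp.wOf_dotProduct_c v)]
    exact ⟨hv, x, hx⟩

/-- Thus `M = univ` at the end of a round certifies that no vertex was cut off in it. -/
lemma halfspace_ne_univ (T : Matrix (Fin (m + 1)) (Fin (m + 1)) ℝ) (y : Fin (m + 1) → ℝ) :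
    {t : Fin (m + 1) → ℝ | t (Fin.last m) ≤ wOf T t ⬝ᵥ y} ≠ univ := by
  intro h
  have : Function.update (0 : Fin (m + 1) → ℝ) (Fin.last m) (wOf T 0 ⬝ᵥ y + 1) ∈
      {t : Fin (m + 1) → ℝ | t (Fin.last m) ≤ wOf T t ⬝ᵥ y} := h ▸ mem_univ _
  rw [mem_ofPred_eq, wOf_update, Function.update_self] at this
  linarith

lemma DualInvariant.dualBody (hp : p.Admissible P) (h : DualInvariant P p Y X₀ s)
    (hbody : dualBody P p ε s s') : DualInvariant P p Y X₀ s' ∧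
      (s'.M = univ → (s'.D.extremePoints ℝ).Finite ∧
        ∀ v ∈ s'.D.extremePoints ℝ, VertexDone P p ε v s') := by
  obtain ⟨s₁, hfor, hcase⟩ := hbody
  obtain ⟨hinv, hMc, hM, hD⟩ := hfor.invariant
    (I := fun a => DualInvariant P p Y X₀ a ∧ IsClosed a.M ∧
      (∀ t, (∀ x ∈ a.Xbar, t (Fin.last m) ≤ wOf p.T t ⬝ᵥ P.Γ x) → t ∈ a.M) ∧ a.D = s.D)
    (by
      rintro v hv a a' ⟨ha, hMc, hM, hD⟩ ⟨x, hx, ⟨-, rfl⟩ | ⟨-, rfl⟩⟩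
      · refine ⟨ha.insert hp (h.mem_dual v (extremePoints_subset hv)) hx, ?_, ?_, hD⟩
        · exact hMc.inter (isClosed_le (continuous_apply _) (continuous_wOf_dotProduct _ _))
        · exact fun t ht => ⟨hM t (forall_mem_insert.1 ht).2, (forall_mem_insert.1 ht).1⟩
      · exact ⟨ha.insert hp (h.mem_dual v (extremePoints_subset hv)) hx, hMc,
          fun t ht => hM t (forall_mem_insert.1 ht).2, hD⟩)
    ⟨{ h with }, isClosed_univ, fun _ _ => mem_univ _, rfl⟩
  have hdone := hfor.forall_mem (Q := fun v a => a.M = univ → VertexDone P p ε v a)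
    (by
      rintro v a a' ⟨x, hx, ⟨-, rfl⟩ | ⟨hle, rfl⟩⟩ hMu
      · exact absurd (univ_subset_iff.1 (hMu ▸ inter_subset_right)) (halfspace_ne_univ p.T (P.Γ x))
      · exact ⟨x, hx, hle, mem_insert _ _⟩)
    (by
      rintro v v' a a' hQ ⟨x, hx, ⟨-, rfl⟩ | ⟨hle, rfl⟩⟩ hMu
      · exact absurd (univ_subset_iff.1 (hMu ▸ inter_subset_right)) (halfspace_ne_univ p.T (P.Γ x))
      · obtain ⟨y, hy, hle', hmem⟩ := hQ hMu
        exact ⟨y, hy, hle', mem_insert_of_mem _ hmem⟩)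
  rcases hcase with ⟨hne, rfl⟩ | ⟨hMu, rfl⟩
  · refine ⟨{ hinv with
      isClosed_D := hinv.isClosed_D.inter hMc
      mem_dual := fun t ht => hinv.mem_dual t ht.1
      last_le := fun t ht => hinv.last_le t ht.1
      mem_D := fun t h1 h2 => ⟨hinv.mem_D t h1 h2, hM t h2⟩ }, fun hMu => absurd hMu hne⟩
  · refine ⟨hinv, fun _ => ?_⟩
    rw [hD]
    exact ⟨hfor.finite, fun v hv => hdone v hv hMu⟩

/-- The final outer approximation is generated by its vertices and `-K`. -/
lemma DualInvariant.subset_convexHull_sub_coneK (hp : p.Admissible P)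
    (h : DualInvariant P p Y X₀ s) (hc : p.c ∈ interior (cone Y)) (hX₀ : X₀.Nonempty)
    (hfin : (s.D.extremePoints ℝ).Finite) :
    s.D ⊆ convexHull ℝ (s.D.extremePoints ℝ) - coneK m := by
  obtain ⟨x, hx⟩ := hX₀
  have hcomp := isCompact_dualCone_section hc
  obtain ⟨B₁, hB₁⟩ := hcomp.exists_bound_of_continuousOn (f := fun w => p.Tᵀ *ᵥ w)
    (Continuous.matrix_mulVec continuous_const continuous_id).continuousOn
  obtain ⟨B₂, hB₂⟩ := hcomp.exists_bound_of_continuousOn (f := fun w => w ⬝ᵥ P.Γ x)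
    (Continuous.dotProduct continuous_id continuous_const).continuousOn
  have hmem : ∀ t ∈ s.D, wOf p.T t ∈ {w | w ∈ dualCone (cone Y) ∧ w ⬝ᵥ p.c = 1} := fun t ht =>
    ⟨h.mem_dual t ht, hp.wOf_dotProduct_c t⟩
  refine subset_convexHull_extremePoints_sub_coneK h.isClosed_D (B := max B₁ B₂) ?_ ?_ hfin
  · intro t ht i hi
    have h1 := (norm_le_pi_norm _ i).trans (hB₁ _ (hmem t ht))
    rw [hp.transpose_mulVec_wOf, Function.update_of_ne hi] at h1
    exact h1.trans (le_max_left _ _)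
  · intro t ht
    exact (h.last_le t ht x hx).trans
      ((le_abs_self _).trans ((hB₂ _ (hmem t ht)).trans (le_max_right _ _)))

/-- The final outer approximation exceeds the lower image by at most `ε`. -/
lemma DualInvariant.last_sub_le (hsub : s.D ⊆ convexHull ℝ (s.D.extremePoints ℝ) - coneK m)
    (hdone : ∀ v ∈ s.D.extremePoints ℝ, VertexDone P p ε v s) :
    ∀ t ∈ s.D, ∀ x ∈ P.X, t (Fin.last m) - ε ≤ wOf p.T t ⬝ᵥ P.Γ x := by
  intro t ht x hx
  obtain ⟨u, hu, _, ⟨k, hk, rfl⟩, rfl⟩ := hsub ht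
  -- The inequality is affine in `t`, because `w` is.
  have hconv : Convex ℝ {t : Fin (m + 1) → ℝ | t (Fin.last m) - ε ≤ wOf p.T t ⬝ᵥ P.Γ x} := by
    intro t ht u hu a b ha hb hab
    have ht : t (Fin.last m) - ε ≤ wOf p.T t ⬝ᵥ P.Γ x := ht
    have hu : u (Fin.last m) - ε ≤ wOf p.T u ⬝ᵥ P.Γ x := hu
    rw [mem_ofPred_eq, wOf_combo _ _ _ hab, add_dotProduct, smul_dotProduct, smul_dotProduct]
    simp only [Pi.add_apply, Pi.smul_apply, smul_eq_mul]
    have h1 := mul_le_mul_of_nonneg_left ht ha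
    have h2 := mul_le_mul_of_nonneg_left hu hb
    have h3 : ε = a * ε + b * ε := by rw [← add_mul, hab, one_mul]
    linarith
  have hmem := convexHull_min (fun v hv => ?_) hconv hu
  · have hmem : u (Fin.last m) - ε ≤ wOf p.T u ⬝ᵥ P.Γ x := hmem
    have hw : wOf p.T (u - Pi.single (Fin.last m) k) = wOf p.T u := by
      refine wOf_congr (funext fun j => ?_)
      simp [Fin.init]
    change (u - Pi.single (Fin.last m) k : Fin (m + 1) → ℝ) (Fin.last m) - ε ≤
      wOf p.T (u - Pi.single (Fin.last m) k) ⬝ᵥ P.Γ x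
    rw [hw, Pi.sub_apply, Pi.single_eq_same]
    linarith
  · obtain ⟨y, hy, hle, -⟩ := hdone v hv
    change v (Fin.last m) - ε ≤ wOf p.T v ⬝ᵥ P.Γ x
    linarith [hy.2 x hx]

lemma DualInvariant.lowerImage_subset (hP : P.Assumption) (hp : p.Admissible P)
    (h : DualInvariant P p Y X₀ s) (hsub : s.D ⊆ convexHull ℝ (s.D.extremePoints ℝ) - coneK m)
    (hdone : ∀ v ∈ s.D.extremePoints ℝ, VertexDone P p ε v s) :
    lowerImage P p.T (cone Y) ⊆
      toExt '' (convexHull ℝ (toExt ⁻¹' (dualObjective P p.T '' s.Tbar)) - coneK m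
        + {Pi.single (Fin.last m) ε}) := by
  rintro _ ⟨t, ht, k, hk, rfl⟩
  -- The infimum is finite: lowering the last coordinate of `t` to `γ`, a lower bound of the stored
  -- values, gives a point of `D`, where the `ε`-estimate yields the bound `γ - ε` over all of `X`.
  obtain ⟨r, hr⟩ : ∃ r : ℝ, (⨅ x ∈ P.X, ((wOf p.T t ⬝ᵥ P.Γ x : ℝ) : EReal)) = (r : EReal) := by
    obtain ⟨x₀, hx₀⟩ := hP.X_nonempty
    obtain ⟨γ, hγ⟩ := (h.finite_X.image fun x => wOf p.T t ⬝ᵥ P.Γ x).bddBelow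
    have hD : Function.update t (Fin.last m) γ ∈ s.D := by
      refine h.mem_D _ (by rw [wOf_update]; exact ht) fun x hx => ?_
      rw [wOf_update, Function.update_self]
      exact hγ ⟨x, hx, rfl⟩
    have hlow := DualInvariant.last_sub_le hsub hdone _ hD
    rw [wOf_update, Function.update_self] at hlow
    refine ⟨_, (EReal.coe_toReal (ne_top_of_le_ne_top (EReal.coe_ne_top _) (iInf₂_le x₀ hx₀))
      (ne_bot_of_le_ne_bot (EReal.coe_ne_bot (γ - ε)) (le_iInf₂ fun x hx => ?_))).symm⟩
    exact EReal.coe_le_coe_iff.2 (hlow x hx)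
  have hrx : ∀ x ∈ P.X, r ≤ wOf p.T t ⬝ᵥ P.Γ x := fun x hx => by
    rw [← EReal.coe_le_coe_iff, ← hr]
    exact iInf₂_le x hx
  have hD : Function.update t (Fin.last m) (r - k) ∈ s.D := by
    refine h.mem_D _ (by rw [wOf_update]; exact ht) fun x hx => ?_
    obtain ⟨w, -, -, hx'⟩ := h.X_optimal x hx
    rw [wOf_update, Function.update_self]
    linarith [hrx x hx'.1]
  refine ⟨Function.update t (Fin.last m) (r - k), ?_, ?_⟩
  · set S := toExt ⁻¹' (dualObjective P p.T '' s.Tbar) with hS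
    obtain ⟨u, hu, _, ⟨l, hl, rfl⟩, he⟩ := hsub hD
    have hconv : Convex ℝ (convexHull ℝ S - coneK m + {Pi.single (Fin.last m) ε}) :=
      ((convex_convexHull ℝ S).sub (convex_coneK m)).add (convex_singleton _)
    have hmem : u ∈ convexHull ℝ S - coneK m + {Pi.single (Fin.last m) ε} := by
      refine convexHull_min (fun v hv => ?_) hconv hu
      obtain ⟨x, hx, hle, hT⟩ := hdone v hv
      set β := wOf p.T v ⬝ᵥ P.Γ x with hβ
      -- The vertex is its dual value point minus `(β + ε - v_q) e^q` plus `ε e^q`; the coefficient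
      -- is nonnegative because `v` passed the `ε` test.
      refine ⟨Function.update v (Fin.last m) β - Pi.single (Fin.last m) (β + ε - v (Fin.last m)),
        ⟨_, subset_convexHull ℝ _ ?_, _, ⟨_, by linarith, rfl⟩, rfl⟩, _, rfl, ?_⟩
      · refine ⟨_, hT, ?_⟩
        have hw := hp.wOf_transpose_mulVec (hp.wOf_dotProduct_c v)
        rw [dualObjective_eq_of_P1Optimal (x := x) (by rwa [hw]), hw, hp.transpose_mulVec_wOf]
        simp [toExt, hβ]
      · ext i
        by_cases hi : i = Fin.last m
        · subst hi; simp; ring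
        · simp [hi]
    obtain ⟨_, ⟨a, ha, _, ⟨j, hj, rfl⟩, rfl⟩, _, rfl, rfl⟩ := hmem
    rw [← he]
    refine ⟨a - Pi.single (Fin.last m) (j + l), ⟨a, ha, _, ⟨_, add_nonneg hj hl, rfl⟩, rfl⟩,
      _, rfl, ?_⟩
    simp only [Pi.single_add]
    abel
  · refine Prod.ext ?_ ?_
    · simp [toExt, shift, dualObjective]
    · simp only [toExt, shift, dualObjective, hr, Function.update_self]
      rw [← EReal.coe_add, sub_eq_add_neg]

lemma DualInvariant.upperImage_subset (hp : p.Admissible P)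
    (h : DualInvariant P p Y X₀ s) (hc : p.c ∈ interior (cone Y)) (hX₀ : X₀.Nonempty)
    (hCY : (P.C : Set (Fin (m + 1) → ℝ)) ⊆ cone Y) (hY : IsClosed (cone Y))
    (hlast : ∀ t ∈ s.D, ∀ x ∈ P.X, t (Fin.last m) - ε ≤ wOf p.T t ⬝ᵥ P.Γ x) :
    P.upperImage ⊆ convexHull ℝ (P.Γ '' s.Xbar) + cone Y - {ε • p.c} := by
  intro y hy
  by_contra hnot
  have hclosed : IsClosed (convexHull ℝ (P.Γ '' s.Xbar) + cone Y - {ε • p.c}) := by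
    rw [sub_eq_add_neg, neg_singleton]
    exact (hY.add_left_of_isCompact
      ((h.finite_X.image _).isCompact_convexHull ℝ)).add_right_of_isCompact isCompact_singleton
  obtain ⟨w, γ, h1, h2⟩ := exists_dotProduct_lt_of_notMem
    (((convex_convexHull ℝ _).add (convex_cone Y)).sub (convex_singleton _)) hclosed hnot
  have hq : ∀ x ∈ s.Xbar, ∀ a ∈ cone Y, γ < w ⬝ᵥ P.Γ x + w ⬝ᵥ a - ε * (w ⬝ᵥ p.c) := by
    intro x hx a ha
    have := h2 (P.Γ x + a - ε • p.c)
      ⟨_, ⟨_, subset_convexHull ℝ _ ⟨x, hx, rfl⟩, a, ha, rfl⟩, _, rfl, rfl⟩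
    rwa [dotProduct_sub, dotProduct_add, dotProduct_smul, smul_eq_mul] at this
  obtain ⟨x₁, hx₁⟩ := hX₀
  have hx₁ := h.subset_X hx₁
  have hwY : w ∈ dualCone (cone Y) := fun a ha =>
    nonneg_of_forall_lt_mul (γ := γ) (b := w ⬝ᵥ P.Γ x₁ - ε * (w ⬝ᵥ p.c)) fun k hk => by
      have := hq x₁ hx₁ _ (smul_mem_cone hk ha)
      rw [dotProduct_smul, smul_eq_mul] at this
      linarith
  have hw0 : w ≠ 0 := by
    rintro rfl
    have := hq x₁ hx₁ 0 (zero_mem_cone Y)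
    simp only [zero_dotProduct] at this h1
    linarith
  have hκ : 0 < w ⬝ᵥ p.c := dotProduct_pos_of_mem_interior hwY hw0 hc
  set κ := w ⬝ᵥ p.c with hκdef
  have hw1 : (κ⁻¹ • w) ⬝ᵥ p.c = 1 := by
    rw [smul_dotProduct, smul_eq_mul, ← hκdef, inv_mul_cancel₀ hκ.ne']
  -- Separation at the stored points gives `κ⁻¹γ + ε ≤ (κ⁻¹w)ᵀΓ(x)`, that is, `t ∈ D`. The `ε` lost
  -- in `hlast` then leaves exactly `γ ≤ wᵀΓ(x)` on `X`, contradicting `wᵀy < γ`.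
  set t := Function.update (p.Tᵀ *ᵥ (κ⁻¹ • w)) (Fin.last m) (κ⁻¹ * γ + ε) with ht
  have hwt : wOf p.T t = κ⁻¹ • w := by rw [ht, wOf_update, hp.wOf_transpose_mulVec hw1]
  have htD : t ∈ s.D := by
    refine h.mem_D t ?_ fun x hx => ?_
    · rw [hwt]
      intro a ha
      rw [smul_dotProduct]
      exact mul_nonneg (inv_nonneg.2 hκ.le) (hwY a ha)
    · have h3 := hq x hx 0 (zero_mem_cone Y)
      rw [dotProduct_zero, add_zero] at h3
      have h4 := mul_le_mul_of_nonneg_left h3.le (inv_nonneg.2 hκ.le)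
      have h5 : κ⁻¹ * (ε * κ) = ε := by field_simp
      rw [mul_sub, h5] at h4
      rw [hwt, ht, Function.update_self, smul_dotProduct, smul_eq_mul]
      linarith
  have hX : ∀ x ∈ P.X, γ ≤ w ⬝ᵥ P.Γ x := by
    intro x hx
    have h3 := hlast t htD x hx
    rw [hwt, ht, Function.update_self, smul_dotProduct, smul_eq_mul, add_sub_cancel_right] at h3
    exact le_of_mul_le_mul_left h3 (inv_pos.2 hκ)
  have := CVOP.le_dotProduct_of_mem_upperImage (dualCone_anti hCY hwY) hX y hy
  linarith

end MainLoop

end UnboundedCVOP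

/-! ### Assembly of the theorem -/

open UnboundedCVOP in
theorem mainTheorem4 {n m : ℕ} (P : CVOP n m) (hP : P.Assumption)
    (p : Params m) (hp : p.Admissible P) (ε δ : ℝ) (hε : 0 < ε) (hδ : 0 < δ)
    (Xbar : Set (Fin n → ℝ)) (YOut Tbar : Set (Fin (m + 1) → ℝ))
    (hrun : DualAlgorithmOutputs P p ε δ Xbar YOut Tbar) :
    (P.upperImage ≠ Set.univ → P.IsFiniteWeakSolution p.c ε δ Xbar YOut) ∧
      IsFiniteDualSolution P p.T ε δ Tbar YOut := by
  obtain ⟨s₀, hinit, -, s, hwhile, rfl, rfl, rfl⟩ := hrun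
  obtain ⟨F, hG⟩ := hinit.guarantee hP hp hδ.le
  have hc := hG.interior_cone hp
  have hCY : (P.C : Set (Fin (m + 1) → ℝ)) ⊆ cone s₀.YOut :=
    CVOP.cone_subset_recessionCone_upperImage.trans hG.outer.1
  obtain ⟨hinv, hfinal⟩ := hwhile.invariant
    (I := fun a => DualInvariant P p s₀.YOut s₀.Xbar a ∧
      (a.M = univ → (a.D.extremePoints ℝ).Finite ∧
        ∀ v ∈ a.D.extremePoints ℝ, VertexDone P p ε v a))
    (fun _ _ ha hb => ha.1.dualBody hp hb)
    -- The initial value `M = ∅` makes the claim about vertices vacuous before the first round.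
    ⟨hG.dualInvariant hp, fun h => absurd h empty_ne_univ⟩
  obtain ⟨hfin, hdone⟩ := hfinal (not_not.1 hwhile.2)
  have hmax : ∀ t ∈ s.Tbar, IsDualMaximizer P p.T (cone s₀.YOut) t := fun t ht =>
    let ⟨h1, _, h2⟩ := hinv.T_optimal t ht
    isDualMaximizer_of_P1Optimal h1 h2
  rcases F.eq_empty_or_nonempty with hF | hF
  · have hrec := hG.recession_univ hF
    refine ⟨fun hne => absurd
      (eq_univ_of_recessionCone_eq_univ hP.upperImage_nonempty hrec) hne, hG.finite_YOut, hG.outer,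
      hinv.finite_T, hmax, ?_⟩
    -- Here `-c ∈ cone YOut`, whereas `w(t)ᵀ(-c) = -1`: no `t` is feasible and the lower image is
    -- empty.
    rintro _ ⟨t, ht, -⟩
    have h1 := ht (-p.c) (hG.outer.1 (hrec ▸ mem_univ _))
    rw [dotProduct_neg, hp.wOf_dotProduct_c] at h1
    linarith
  · have hX₀ : s₀.Xbar.Nonempty := by rw [hG.Xbar_eq]; exact hF.image _
    have hsub := hinv.subset_convexHull_sub_coneK hp hc hX₀ hfin
    refine ⟨fun _ => ⟨hinv.finite_X, hG.finite_YOut, hX₀.mono hinv.subset_X, fun x hx => ?_,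
      hG.outer, hinv.upperImage_subset hp hc hX₀ hCY hG.isClosed_cone
        (DualInvariant.last_sub_le hsub hdone)⟩, hG.finite_YOut, hG.outer,
      hinv.finite_T, hmax, hinv.lowerImage_subset hP hp hsub hdone⟩
    obtain ⟨w, hw, h0, hopt⟩ := hinv.X_optimal x hx
    exact hopt.isWeakMinimizer (dualCone_anti hCY hw) h0
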